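/- Let $F$ be a distribution function on $\mathbb{R}$, let $U(t)=F^{\leftarrow}(1-1/t)$, $t>1$, be its tail quantile function, where $F^{\leftarrow}(u)=\inf\{x: F(x)\ge u\}$, and let $t_0>1$ be such that $U(t_0)>0$. Let $\gamma>0$, $\alpha=1/\gamma$, and let $P_\alpha$ be the Pareto distribution $P_\alpha(x)=1-x^{-\alpha}$, $x>1$. Let $X=U(Z)$ almost surely, where $Z$ is a standard Pareto random variable, $\mathbb{P}(Z>z)=1/z$ for $z\ge 1$; then $X$ has distribution $F$. Let $p\in[1,\infty]$. On $[1,\infty)$ with the distance $d(x,x')=|\log x-\log x'|$ let $$W_p(P_1,P_2)=\inf\{\|d(X_1,X_2)\|_{L^p}: X_1\sim P_1,\ X_2\sim P_2\}\in[0,\infty]$$ be the Wasserstein distance, the infimum being over all couplings. For $t\ge t_0$ let $$A_p(t)=\Big(\int_1^\infty\Big|\log\frac{U(zt)}{z^\gamma U(t)}\Big|^p\frac{dz}{z^2}\Big)^{1/p}\ (p<\infty),\qquad A_\infty(t)=\sup_{z>1}\Big|\log\frac{U(zt)}{z^\gamma U(t)}\Big|,$$ with values in $[0,\infty]$. (i)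 For every $t\ge t_0$, the conditional law $P_{U(t)^{-1}X\mid Z>t}$ of $X/U(t)$ given $Z>t$ satisfies $W_p(P_{U(t)^{-1}X\mid Z>t},P_\alpha)=A_p(t)$. (ii) If $p<\infty$ and $F$ belongs to the max-domain of attraction of $G_\gamma(x)=\exp(-(1+\gamma x)^{-1/\gamma})$, $1+\gamma x>0$ (that is, $F(a_nx+b_n)^n\to G_\gamma(x)$ for all $x$, for some $a_n>0$ and $b_n\in\mathbb{R}$), then $A_p$ is bounded on $[t_0,\infty)$ and $\lim_{t\to\infty}A_p(t)=0$. (iii) Let $\rho\le 0$ and let $A$ be a function that is regularly varying at infinity with index $\rho$ (that is, $A(tx)/A(t)\to x^\rho$ as $t\to\infty$ for all $x>0$), eventually positive or eventually negative, with $A(t)\to0$ as $t\to\infty$. If the second-order condition $$\lim_{t\to\infty}\frac{\frac{U(tx)}{U(t)}-x^\gamma}{A(t)}=x^\gamma\,\frac{x^\rho-1}{\rho},\qquad x>0,$$ holds, then $$\lim_{t\to\infty}\frac{A_p(t)}{|A(t)|}=c_p(\rho):=\begin{cases}\left(\int_1^\infty\left|\frac{z^\rho-1}{\rho}\right|^p\frac{dz}{z^2}\right)^{1/p}&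 p\in[1,\infty),\\ 1/|\rho| & p=\infty,\ \rho<0,\\ +\infty & p=\infty,\ \rho=0.\end{cases}$$ Here $(z^\rho-1)/\rho$ is read as $\log z$ if $\rho=0$. -/

import Mathlib

open Set Filter Topology MeasureTheory ProbabilityTheory
open scoped ENNReal

noncomputable section

namespace ExtremeWasserstein

/-- The Wasserstein distance of order `p ∈ [1,∞]`: the infimum of `‖d(X₁, X₂)‖_{L^p}` over all
couplings `(X₁, X₂)` of `P` and `Q`; a coupling is represented by its joint law `π`. The value `∞`
is possible. -/
def wasserstein {E : Type*} [PseudoMetricSpace E] [MeasurableSpace E]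
    (p : ℝ≥0∞) (P Q : Measure E) : ℝ≥0∞ :=
  ⨅ (π : Measure (E × E)) (_ : π.map Prod.fst = P ∧ π.map Prod.snd = Q),
    eLpNorm (fun z : E × E => dist z.1 z.2) p π

/-- The half-line `[1,∞)`, to be endowed with the logarithmic distance. -/
def LogHalfLine : Type := {x : ℝ // x ∈ Ici (1 : ℝ)}

namespace LogHalfLine

/-- The inclusion of `[1,∞)` in `ℝ`. -/
def val (x : LogHalfLine) : ℝ := Subtype.val x

instance : TopologicalSpace LogHalfLine :=
  inferInstanceAs (TopologicalSpace {x : ℝ // x ∈ Ici (1 : ℝ)})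

instance : MeasurableSpace LogHalfLine :=
  inferInstanceAs (MeasurableSpace {x : ℝ // x ∈ Ici (1 : ℝ)})

instance : BorelSpace LogHalfLine :=
  inferInstanceAs (BorelSpace {x : ℝ // x ∈ Ici (1 : ℝ)})

theorem isEmbedding_log : IsEmbedding (fun x : LogHalfLine => Real.log x.val) := by
  have hpos : ∀ x : LogHalfLine, 0 < x.val := fun x => lt_of_lt_of_le one_pos x.2
  have hval : IsEmbedding (LogHalfLine.val) := IsEmbedding.subtypeVal
  have hc : Continuous (fun x : LogHalfLine => Real.log x.val) :=
    hval.continuous.log fun x => (hpos x).ne'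
  have hcomp : Real.exp ∘ (fun x : LogHalfLine => Real.log x.val) = LogHalfLine.val := by
    funext x
    exact Real.exp_log (hpos x)
  refine IsEmbedding.of_comp hc Real.continuous_exp ?_
  rw [hcomp]
  exact hval

/-- The logarithmic distance `d(x, y) = |log x - log y|` on `[1,∞)`; it induces the usual topology,
and so the Borel `σ`-algebra is the usual one. -/
instance : MetricSpace LogHalfLine := isEmbedding_log.comapMetricSpace _

theorem dist_eq (x y : LogHalfLine) : dist x y = |Real.log x.val - Real.log y.val| := rfl

/-- A law on `ℝ` that is carried by `[1,∞)`, seen as a measure on `[1,∞)`. -/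
def ofReal (P : Measure ℝ) : Measure LogHalfLine := P.comap LogHalfLine.val

end LogHalfLine

/-- The quantile function `F^←(u) = inf {x : F(x) ≥ u}`, `0 < u < 1`, of the law `μ` with
distribution function `F`. -/
def quantile (μ : Measure ℝ) (u : ℝ) : ℝ := sInf {x : ℝ | u ≤ cdf μ x}

/-- The tail quantile function `U(t) = F^←(1 - 1/t)`, `t > 1`. -/
def tailQuantile (μ : Measure ℝ) (t : ℝ) : ℝ := quantile μ (1 - 1 / t)

/-- The distribution function `G_γ` of the extreme value distribution with index `γ`. -/
def gevCDF (γ x : ℝ) : ℝ :=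
  if γ = 0 then Real.exp (-Real.exp (-x))
  else if 0 < 1 + γ * x then Real.exp (-(1 + γ * x) ^ (-1 / γ))
  else if 0 < γ then 0 else 1

/-- `F ∈ D(G_γ)`: for some `a_n > 0` and `b_n`, `F^n(a_n · + b_n)` converges in distribution to
`G_γ`. As `G_γ` is continuous, this is convergence at every point. -/
def InDomainOfAttraction (μ : Measure ℝ) (γ : ℝ) : Prop :=
  ∃ a b : ℕ → ℝ, (∀ n, 0 < a n) ∧
    ∀ x : ℝ, Tendsto (fun n : ℕ => (cdf μ (a n * x + b n)) ^ n) atTop (𝓝 (gevCDF γ x))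

/-- The conditional law of `X / U(t)` given `Z > t`, on `ℝ`. -/
def exceedanceLaw {Ω : Type*} [MeasurableSpace Ω] (Pr : Measure Ω) (X Z : Ω → ℝ)
    (U : ℝ → ℝ) (t : ℝ) : Measure ℝ :=
  (ProbabilityTheory.cond Pr {ω | t < Z ω}).map (fun ω => (U t)⁻¹ * X ω)

/-- The function `A_p`, with values in `[0,∞]`. -/
def Ap (U : ℝ → ℝ) (γ : ℝ) (p : ℝ≥0∞) (t : ℝ) : ℝ≥0∞ :=
  if p = ∞ then ⨆ z ∈ Ioi (1 : ℝ), ENNReal.ofReal |Real.log (U (z * t) / (z ^ γ * U t))|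
  else (∫⁻ z in Ioi (1 : ℝ),
    ENNReal.ofReal (|Real.log (U (z * t) / (z ^ γ * U t))| ^ p.toReal / z ^ 2)) ^ (1 / p.toReal)

/-- `(z^ρ - 1) / ρ`, read as `log z` if `ρ = 0`. -/
def boxCox (ρ z : ℝ) : ℝ := if ρ = 0 then Real.log z else (z ^ ρ - 1) / ρ

/-- Regular variation at infinity with index `ρ`. -/
def RegularlyVarying (A : ℝ → ℝ) (ρ : ℝ) : Prop :=
  ∀ x : ℝ, 0 < x → Tendsto (fun t => A (t * x) / A t) atTop (𝓝 (x ^ ρ))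

/-- The second-order condition on `U` with indices `γ > 0`, `ρ ≤ 0` and normalizing function `A`. -/
structure SecondOrderCondition (U : ℝ → ℝ) (γ ρ : ℝ) (A : ℝ → ℝ) : Prop where
  rho_nonpos : ρ ≤ 0
  regularlyVarying : RegularlyVarying A ρ
  eventually_sign : (∀ᶠ t in atTop, 0 < A t) ∨ (∀ᶠ t in atTop, A t < 0)
  tendsto_zero : Tendsto A atTop (𝓝 0)
  limit : ∀ x : ℝ, 0 < x →
    Tendsto (fun t => (U (t * x) / U t - x ^ γ) / A t) atTop (𝓝 (x ^ γ * boxCox ρ x))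

/-- The constant `c_p(ρ)`, for `ρ ≤ 0`, with values in `[0,∞]`. -/
def cConst (p : ℝ≥0∞) (ρ : ℝ) : ℝ≥0∞ :=
  if p = ∞ then (if ρ = 0 then ∞ else ENNReal.ofReal (1 / |ρ|))
  else (∫⁻ z in Ioi (1 : ℝ),
    ENNReal.ofReal (|boxCox ρ z| ^ p.toReal / z ^ 2)) ^ (1 / p.toReal)

end ExtremeWasserstein

end

namespace ExtremeWasserstein

/-! (i) By lack of memory, `Z` given `Z > t` has the law of `t Z`. The exceedance law is thus the
law of `U(tZ)/U(t)`, while the Pareto law is that of `Z^γ`: two nondecreasing functions of one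
variable. In logarithmic scale the distance is `|x - y|`, and a comonotone coupling minimizes its
`L^p` norm for every `p ≥ 1`. Indeed the mean of `(|x - y| - r)⁺` is an integral over `s` of the
masses of `{x ≤ s, s + r < y}` and its mirror image, and comonotonicity minimizes each of them
(`measure_le_of_comonotone`). The case `p = 1` is `r = 0`, powers `p > 1` are mixtures over `r`, and
`p = ∞` asks for which `r` the mean vanishes. The resulting norm is `A_p`; for `p = ∞`, left
continuity of `U` turns the essential supremum into a supremum.

(ii) Inverting `F^n(a_n x + b_n) → G_γ(x)` gives `(U(ny) - b_n)/a_n → (y^γ - 1)/γ`. Monotonicity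
extends this to real `t`, and ratios of increments eliminate `a_n` and `b_n`. A Stolz–Cesàro
argument (`tendsto_ratio_of_increment_ratio`) then yields `U(ty)/U(t) → y^γ`. Iterated doubling
bounds the log-ratio by `C z^ε` for all `t ≥ t₀`, which gives boundedness and, by dominated
convergence, the limit.

(iii) The log-ratio divided by `A(t)` converges pointwise to `boxCox ρ z`; a dominating function is
needed. With `v(u) = log U(e^u) - γu` and `b(u) = A(e^u)`, the increments of `v` over `[0,1]`,
divided by `b`, converge uniformly (`eventually_forall_increment_close`). Chaining unit steps bounds
all increments by `C ∑ q^j`, with `C` just above `boxCox ρ e` and `q` just above `e^ρ`. For `p < ∞`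
a larger `q = e^ε` suffices for domination. For `p = ∞`, `ρ < 0`, the series tends to `boxCox ρ e /
(1 - e^ρ) = 1/|ρ|`, the sharp constant. A single large `z` gives the lower bound, also when `ρ = 0`.
-/

/-! ### Optimality of comonotone couplings on the line -/

theorem ofReal_abs_sub_sub_eq (x y : ℝ) {r : ℝ} (hr : 0 ≤ r) :
    ENNReal.ofReal (|x - y| - r)
      = (∫⁻ s, {s | x ≤ s ∧ s + r < y}.indicator 1 s)
        + ∫⁻ s, {s | y ≤ s ∧ s + r < x}.indicator 1 s := by
  -- These levels form an interval of length `(y - x - r)⁺`; for given `x`, `y` at most one of the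
  -- two orders contributes.
  have key : ∀ x y : ℝ, (∫⁻ s, {s | x ≤ s ∧ s + r < y}.indicator 1 s) =
      ENNReal.ofReal (y - x - r) := by
    intro x y
    have : {s | x ≤ s ∧ s + r < y} = Ico x (y - r) := by
      ext s; simp [lt_sub_iff_add_lt]
    rw [this, lintegral_indicator_one measurableSet_Ico, Real.volume_Ico]
    congr 1; ring
  rw [key, key]
  rcases le_total x y with h | h
  · rw [ENNReal.ofReal_of_nonpos (p := x - y - r) (by linarith), add_zero, abs_sub_comm,
      abs_of_nonneg (by linarith)]
  · rw [ENNReal.ofReal_of_nonpos (p := y - x - r) (by linarith), zero_add,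
      abs_of_nonneg (by linarith)]

/-- The expected excess of the distance over a level `r`, by slicing. -/
theorem lintegral_ofReal_abs_sub_sub {S : Type*} [MeasurableSpace S] (π : Measure S) [SFinite π]
    {x y : S → ℝ} (hx : Measurable x) (hy : Measurable y) {r : ℝ} (hr : 0 ≤ r) :
    ∫⁻ ω, ENNReal.ofReal (|x ω - y ω| - r) ∂π
      = (∫⁻ s, π {ω | x ω ≤ s ∧ s + r < y ω}) + ∫⁻ s, π {ω | y ω ≤ s ∧ s + r < x ω} := by
  have key : ∀ {x y : S → ℝ}, Measurable x → Measurable y →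
      Measurable (fun ω => ∫⁻ s, {s | x ω ≤ s ∧ s + r < y ω}.indicator (1 : ℝ → ℝ≥0∞) s) ∧
      ∫⁻ ω, (∫⁻ s, {s | x ω ≤ s ∧ s + r < y ω}.indicator 1 s) ∂π
        = ∫⁻ s, π {ω | x ω ≤ s ∧ s + r < y ω} := by
    intro x y hx hy
    have hm : MeasurableSet {q : S × ℝ | x q.1 ≤ q.2 ∧ q.2 + r < y q.1} :=
      (measurableSet_le (hx.comp measurable_fst) measurable_snd).inter
        (measurableSet_lt (measurable_snd.add_const r) (hy.comp measurable_fst))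
    have hm2 : Measurable (fun q : S × ℝ =>
        {q : S × ℝ | x q.1 ≤ q.2 ∧ q.2 + r < y q.1}.indicator (1 : S × ℝ → ℝ≥0∞) q) :=
      measurable_one.indicator hm
    refine ⟨hm2.lintegral_prod_right', ?_⟩
    have := lintegral_lintegral_swap (μ := π) (ν := (volume : Measure ℝ))
      (f := fun ω s => {q : S × ℝ | x q.1 ≤ q.2 ∧ q.2 + r < y q.1}.indicator
        (1 : S × ℝ → ℝ≥0∞) (ω, s)) hm2.aemeasurable
    refine Eq.trans this ?_
    refine lintegral_congr fun s => ?_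
    have hs : MeasurableSet {ω | x ω ≤ s ∧ s + r < y ω} :=
      (measurableSet_le hx measurable_const).inter (measurableSet_lt measurable_const hy)
    exact lintegral_indicator_one hs
  simp_rw [ofReal_abs_sub_sub_eq _ _ hr]
  rw [lintegral_add_left (key hx hy).1, (key hx hy).2, (key hy hx).2]

section Comonotone

variable {S : Type*} [MeasurableSpace S] {π : Measure S}
  {lam : Measure ℝ} [IsFiniteMeasure lam]

/-- Sublevel sets of monotone functions are lower sets of the line, hence nested. The left side is
therefore `0` or a difference of marginal masses, and that difference is a lower bound under every
coupling. -/
theorem measure_le_of_comonotone {f g : ℝ → ℝ} (hf : Monotone f) (hg : Monotone g)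
    {x y : S → ℝ} (hx : Measurable x) (hy : Measurable y)
    (hxf : π.map x = lam.map f) (hyg : π.map y = lam.map g) (a b : ℝ) :
    lam {ω | f ω ≤ a ∧ b < g ω} ≤ π {ω | x ω ≤ a ∧ b < y ω} := by
  have e1 : π (x ⁻¹' Iic a) = lam (f ⁻¹' Iic a) := by
    rw [← Measure.map_apply hx measurableSet_Iic, hxf,
      Measure.map_apply hf.measurable measurableSet_Iic]
  have e2 : π (y ⁻¹' Iic b) = lam (g ⁻¹' Iic b) := by
    rw [← Measure.map_apply hy measurableSet_Iic, hyg,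
      Measure.map_apply hg.measurable measurableSet_Iic]
  have s1 : {ω | f ω ≤ a ∧ b < g ω} = f ⁻¹' Iic a \ g ⁻¹' Iic b := by
    ext ω; simp
  have s2 : {ω | x ω ≤ a ∧ b < y ω} = x ⁻¹' Iic a \ y ⁻¹' Iic b := by
    ext ω; simp
  rw [s1, s2]
  by_cases h : f ⁻¹' Iic a ⊆ g ⁻¹' Iic b
  · rw [sdiff_eq_empty.2 h]; simp
  · have h' : g ⁻¹' Iic b ⊆ f ⁻¹' Iic a := by
      obtain ⟨z, hz, hz'⟩ := not_subset.1 h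
      intro w hw
      simp only [mem_preimage, mem_Iic] at *
      rcases le_total w z with hwz | hwz
      · exact (hf hwz).trans hz
      · exact absurd ((hg hwz).trans hw) hz'
    rw [measure_sdiff h' (hg.measurable measurableSet_Iic).nullMeasurableSet
      (measure_ne_top _ _), ← e1, ← e2]
    exact le_measure_sdiff

theorem lintegral_excess_le_of_comonotone [SFinite π] {f g : ℝ → ℝ} (hf : Monotone f) (hg : Monotone g)
    {x y : S → ℝ} (hx : Measurable x) (hy : Measurable y)
    (hxf : π.map x = lam.map f) (hyg : π.map y = lam.map g) {r : ℝ} (hr : 0 ≤ r) :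
    ∫⁻ z, ENNReal.ofReal (|f z - g z| - r) ∂lam
      ≤ ∫⁻ ω, ENNReal.ofReal (|x ω - y ω| - r) ∂π := by
  rw [lintegral_ofReal_abs_sub_sub _ hf.measurable hg.measurable hr,
    lintegral_ofReal_abs_sub_sub _ hx hy hr]
  gcongr with s s
  · exact measure_le_of_comonotone hf hg hx hy hxf hyg _ _
  · exact measure_le_of_comonotone hg hf hy hx hyg hxf _ _

end Comonotone

/-- A power with exponent `p > 1` as a mixture of the functions `d ↦ (d - r)⁺`. -/
theorem ofReal_rpow_eq_lintegral {p : ℝ} (hp : 1 < p) {d : ℝ} (hd : 0 ≤ d) :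
    ENNReal.ofReal (d ^ p)
      = ∫⁻ r in Ioi (0 : ℝ), ENNReal.ofReal (p * (p - 1) * r ^ (p - 2)) *
          ENNReal.ofReal (d - r) := by
  set φ : ℝ → ℝ := fun r => p * (p - 1) * r ^ (p - 2) * (d - r) with hφ
  have hpos : ∀ r ∈ Ioo 0 d, 0 ≤ φ r := fun r hr => by
    have h1 : 0 ≤ r ^ (p - 2) := Real.rpow_nonneg hr.1.le _
    have h2 : 0 ≤ d - r := by linarith [hr.2]
    have h3 : 0 ≤ p * (p - 1) := mul_nonneg (by linarith) (by linarith)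
    positivity
  -- Integration by parts gives this antiderivative; its values at `0` and `d` are `0` and `d ^ p`.
  have hderiv : ∀ r ∈ Ioo 0 d,
      HasDerivAt (fun r => p * r ^ (p - 1) * (d - r) + r ^ p) (φ r) r := by
    intro r hr
    have h1 := Real.hasDerivAt_rpow_const (x := r) (p := p - 1) (Or.inl hr.1.ne')
    have h2 := Real.hasDerivAt_rpow_const (x := r) (p := p) (Or.inl hr.1.ne')
    refine (((h1.const_mul p).mul ((hasDerivAt_id r).const_sub d)).add h2).congr_deriv ?_
    simp only [hφ, id, show p - 1 - 1 = p - 2 by ring]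
    ring
  have hcont : ContinuousOn (fun r => p * r ^ (p - 1) * (d - r) + r ^ p) (Icc 0 d) := by
    have c1 : Continuous fun r : ℝ => r ^ (p - 1) :=
      Real.continuous_rpow_const (by linarith)
    have c2 : Continuous fun r : ℝ => r ^ p := Real.continuous_rpow_const (by linarith)
    exact Continuous.continuousOn (by fun_prop)
  -- The integrand is singular at `0` when `p < 2`. It is integrable as a nonnegative derivative of
  -- a function continuous up to the endpoints.
  have hint : IntegrableOn φ (Ioc 0 d) :=
    intervalIntegral.integrableOn_deriv_of_nonneg hcont hderiv hpos
  have hval : ∫ r in (0 : ℝ)..d, φ r = d ^ p := by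
    rw [intervalIntegral.integral_eq_sub_of_hasDerivAt_of_le hd hcont hderiv
      ((intervalIntegrable_iff_integrableOn_Ioc_of_le hd).2 hint)]
    rw [Real.zero_rpow (by linarith), Real.zero_rpow (by linarith)]
    ring
  have h0 : ∀ r ∈ Ioi (0 : ℝ), ENNReal.ofReal (p * (p - 1) * r ^ (p - 2)) *
      ENNReal.ofReal (d - r) = (Ioo 0 d).indicator (fun r => ENNReal.ofReal (φ r)) r := by
    intro r hr
    have h1 : 0 ≤ p * (p - 1) * r ^ (p - 2) :=
      mul_nonneg (mul_nonneg (by linarith) (by linarith)) (Real.rpow_nonneg (le_of_lt hr) _)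
    by_cases hrd : r < d
    · rw [indicator_of_mem (show r ∈ Ioo 0 d from ⟨hr, hrd⟩), ← ENNReal.ofReal_mul h1]
    · rw [indicator_of_notMem (fun h => hrd h.2), ENNReal.ofReal_of_nonpos (p := d - r)
        (by linarith), mul_zero]
  rw [setLIntegral_congr_fun measurableSet_Ioi h0, lintegral_indicator measurableSet_Ioo,
    Measure.restrict_restrict measurableSet_Ioo,
    inter_eq_left.2 (show Ioo 0 d ⊆ Ioi 0 from fun r hr => hr.1), ← hval,
    intervalIntegral.integral_of_le hd, integral_Ioc_eq_integral_Ioo,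
    ofReal_integral_eq_lintegral_ofReal (hint.mono_set Ioo_subset_Ioc_self)]
  filter_upwards [ae_restrict_mem measurableSet_Ioo] with r hr using hpos r hr

theorem lintegral_rpow_eq_lintegral_excess {S : Type*} [MeasurableSpace S] (π : Measure S)
    [SFinite π] {x y : S → ℝ} (hx : Measurable x) (hy : Measurable y) {p : ℝ} (hp : 1 < p) :
    ∫⁻ ω, ENNReal.ofReal (|x ω - y ω| ^ p) ∂π
      = ∫⁻ r in Ioi (0 : ℝ), ENNReal.ofReal (p * (p - 1) * r ^ (p - 2)) *
          ∫⁻ ω, ENNReal.ofReal (|x ω - y ω| - r) ∂π := by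
  simp_rw [ofReal_rpow_eq_lintegral hp (abs_nonneg _)]
  rw [lintegral_lintegral_swap]
  · refine lintegral_congr fun r => ?_
    rw [lintegral_const_mul _ (by fun_prop)]
  · refine Measurable.aemeasurable ?_
    simp only [Function.uncurry_def]
    fun_prop

/-- Comonotone couplings minimize the `L^p` distance on the real line. -/
theorem eLpNorm_sub_le_of_comonotone {S : Type*} [MeasurableSpace S] {π : Measure S} [SFinite π]
    {lam : Measure ℝ} [IsFiniteMeasure lam] {f g : ℝ → ℝ} (hf : Monotone f) (hg : Monotone g)
    {x y : S → ℝ} (hx : Measurable x) (hy : Measurable y)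
    (hxf : π.map x = lam.map f) (hyg : π.map y = lam.map g) {p : ℝ≥0∞} (hp : 1 ≤ p) :
    eLpNorm (fun z => f z - g z) p lam ≤ eLpNorm (fun ω => x ω - y ω) p π := by
  have hex := fun {r : ℝ} (hr : 0 ≤ r) =>
    lintegral_excess_le_of_comonotone hf hg hx hy hxf hyg hr
  by_cases htop : p = ∞
  · subst htop
    rw [eLpNorm_exponent_top, eLpNorm_exponent_top]
    set c := eLpNormEssSup (fun ω => x ω - y ω) π with hc
    by_cases hcT : c = ∞
    · rw [hcT]; exact le_top
    -- The excess over the essential supremum `c` vanishes for the given coupling, hence also for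
    -- the comonotone one.
    have h1 : ∀ᵐ ω ∂π, ENNReal.ofReal (|x ω - y ω| - c.toReal) = 0 := by
      filter_upwards [ae_le_eLpNormEssSup (f := fun ω => x ω - y ω) (μ := π)] with ω hω
      rw [ENNReal.ofReal_eq_zero, sub_nonpos, ← Real.norm_eq_abs, ← toReal_enorm]
      exact ENNReal.toReal_mono hcT hω
    have h2 := hex (r := c.toReal) ENNReal.toReal_nonneg
    rw [lintegral_congr_ae h1, lintegral_zero, nonpos_iff_eq_zero,
      lintegral_eq_zero_iff (by have := hf.measurable; have := hg.measurable; fun_prop)] at h2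
    refine essSup_le_of_ae_le _ ?_
    filter_upwards [h2] with z hz
    rw [Pi.zero_apply, ENNReal.ofReal_eq_zero, sub_nonpos] at hz
    rw [Real.enorm_eq_ofReal_abs]
    exact ENNReal.ofReal_le_of_le_toReal hz
  · have hp0 : p ≠ 0 := (zero_lt_one.trans_le hp).ne'
    have hp1 : 1 ≤ p.toReal := by
      rw [← ENNReal.toReal_one]; exact ENNReal.toReal_mono htop hp
    rw [eLpNorm_eq_lintegral_rpow_enorm_toReal hp0 htop,
      eLpNorm_eq_lintegral_rpow_enorm_toReal hp0 htop]
    have he : ∀ d : ℝ, ‖d‖ₑ ^ p.toReal = ENNReal.ofReal (|d| ^ p.toReal) := fun d => by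
      rw [Real.enorm_eq_ofReal_abs, ENNReal.ofReal_rpow_of_nonneg (abs_nonneg _) (by linarith)]
    simp_rw [he]
    refine ENNReal.rpow_le_rpow ?_ (by positivity)
    rcases hp1.eq_or_lt with h | h
    · rw [← h]
      simpa using hex le_rfl
    · rw [lintegral_rpow_eq_lintegral_excess _ hf.measurable hg.measurable h,
        lintegral_rpow_eq_lintegral_excess _ hx hy h]
      refine setLIntegral_mono' measurableSet_Ioi fun r hr => ?_
      gcongr
      exact hex (le_of_lt hr)

/-! ### Monotonicity and left continuity of the tail quantile function -/

section TailQuantile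

variable (μ : Measure ℝ)

theorem one_sub_one_div_mem_Ioo {t : ℝ} (ht : 1 < t) : 1 - 1 / t ∈ Ioo (0 : ℝ) 1 := by
  have h0 : 0 < 1 / t := by positivity
  have h1 : 1 / t < 1 := by rw [div_lt_one (by linarith)]; exact ht
  constructor <;> linarith

theorem nonempty_le_cdf {u : ℝ} (hu : u < 1) : {x | u ≤ cdf μ x}.Nonempty :=
  ((tendsto_cdf_atTop μ).eventually (lt_mem_nhds hu)).exists.imp fun _ h => h.le

theorem bddBelow_le_cdf {u : ℝ} (hu : 0 < u) : BddBelow {x | u ≤ cdf μ x} := by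
  obtain ⟨b, hb⟩ := ((tendsto_cdf_atBot μ).eventually (gt_mem_nhds hu)).exists
  refine ⟨b, fun x hx => ?_⟩
  by_contra h
  exact absurd (monotone_cdf μ (not_le.1 h).le) (not_le.2 (hb.trans_le hx))

theorem tailQuantile_le {t y : ℝ} (ht : 1 < t) (h : 1 - 1 / t ≤ cdf μ y) :
    tailQuantile μ t ≤ y :=
  csInf_le (bddBelow_le_cdf μ (one_sub_one_div_mem_Ioo ht).1) h

theorem le_tailQuantile {t y : ℝ} (ht : 1 < t) (h : cdf μ y < 1 - 1 / t) :
    y ≤ tailQuantile μ t := by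
  refine le_csInf (nonempty_le_cdf μ (one_sub_one_div_mem_Ioo ht).2) fun x hx => ?_
  by_contra h'
  exact absurd (monotone_cdf μ (not_le.1 h').le) (not_le.2 (h.trans_le hx))

theorem cdf_lt_of_lt_tailQuantile {t y : ℝ} (ht : 1 < t) (h : y < tailQuantile μ t) :
    cdf μ y < 1 - 1 / t := by
  by_contra h'
  exact absurd (tailQuantile_le μ ht (not_lt.1 h')) (not_le.2 h)

theorem monotoneOn_tailQuantile : MonotoneOn (tailQuantile μ) (Ioi 1) := by
  intro s hs t ht hst
  have hs0 : (0 : ℝ) < s := zero_lt_one.trans hs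
  refine csInf_le_csInf (bddBelow_le_cdf μ (one_sub_one_div_mem_Ioo hs).1)
    (nonempty_le_cdf μ (one_sub_one_div_mem_Ioo ht).2) fun x hx => ?_
  exact le_trans (sub_le_sub_left (one_div_le_one_div_of_le hs0 hst) 1) hx

/-- The condition `cdf μ y < 1 - 1 / s` is open in `s`, which gives the lower bound; monotonicity
gives the upper one. This is what equates supremum and essential supremum in `A_∞`. -/
theorem continuousWithinAt_tailQuantile {s : ℝ} (hs : 1 < s) :
    ContinuousWithinAt (tailQuantile μ) (Iio s) s := by
  have hev : ∀ᶠ s' in 𝓝[<] s, 1 < s' ∧ s' < s :=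
    (eventually_nhdsWithin_of_eventually_nhds (lt_mem_nhds hs)).and self_mem_nhdsWithin
  refine tendsto_order.2 ⟨fun y hy => ?_, fun y hy => ?_⟩
  · obtain ⟨y', hy, hy'⟩ := exists_between hy
    have h1 := cdf_lt_of_lt_tailQuantile μ hs hy'
    have hc : ContinuousAt (fun r : ℝ => 1 - 1 / r) s :=
      continuousAt_const.sub (continuousAt_const.div continuousAt_id (by positivity))
    filter_upwards [hev, eventually_nhdsWithin_of_eventually_nhds
      (hc.tendsto.eventually (lt_mem_nhds h1))] with s' h2 h3
    exact hy.trans_le (le_tailQuantile μ h2.1 h3)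
  · filter_upwards [hev] with s' h2
    exact (monotoneOn_tailQuantile μ h2.1 hs h2.2.le).trans_lt hy

end TailQuantile

/-! ### Pareto laws -/

section Pareto

instance : IsProbabilityMeasure (paretoMeasure 1 1) :=
  isProbabilityMeasure_paretoMeasure one_pos one_pos

theorem lintegral_paretoMeasure {φ : ℝ → ℝ≥0∞} (a : ℝ) (hφ : Measurable φ) :
    ∫⁻ z, φ z ∂(paretoMeasure 1 a)
      = ∫⁻ z in Ioi (1 : ℝ), ENNReal.ofReal (a * z ^ (-(a + 1))) * φ z := by
  have hm : Measurable (paretoPDF 1 a) := (measurable_paretoPDFReal 1 a).ennreal_ofReal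
  rw [paretoMeasure, lintegral_withDensity_eq_lintegral_mul _ hm hφ,
    ← setLIntegral_congr Ioi_ae_eq_Ici.symm, ← lintegral_indicator measurableSet_Ici]
  refine lintegral_congr fun z => ?_
  by_cases hz : 1 ≤ z
  · rw [indicator_of_mem (show z ∈ Ici 1 from hz), Pi.mul_apply, paretoPDF_of_le hz,
      Real.one_rpow, mul_one]
  · rw [indicator_of_notMem (show z ∉ Ici 1 from hz), Pi.mul_apply,
      paretoPDF_of_lt (not_le.1 hz), zero_mul]

theorem paretoMeasure_Ioi {a : ℝ} (ha : 0 < a) {x : ℝ} (hx : 1 ≤ x) :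
    paretoMeasure 1 a (Ioi x) = ENNReal.ofReal (x ^ (-a)) := by
  have hx0 : 0 < x := by linarith
  rw [← lintegral_indicator_one measurableSet_Ioi,
    lintegral_paretoMeasure a (measurable_one.indicator measurableSet_Ioi)]
  have h1 : ∀ z, ENNReal.ofReal (a * z ^ (-(a + 1))) * (Ioi x).indicator 1 z
      = (Ioi x).indicator (fun z => ENNReal.ofReal (a * z ^ (-(a + 1)))) z := by
    intro z
    by_cases hz : z ∈ Ioi x <;> simp [hz]
  simp_rw [h1]
  rw [lintegral_indicator measurableSet_Ioi, Measure.restrict_restrict measurableSet_Ioi,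
    inter_eq_left.2 (Ioi_subset_Ioi hx), ← ofReal_integral_eq_lintegral_ofReal]
  · rw [integral_const_mul, integral_Ioi_rpow_of_lt (by linarith) hx0]
    congr 1
    rw [show -(a + 1) + 1 = -a by ring]
    field_simp
  · exact (integrableOn_Ioi_rpow_of_lt (by linarith) hx0).const_mul a
  · filter_upwards [ae_restrict_mem measurableSet_Ioi] with z hz
    have : 0 < z := hx0.trans hz
    positivity

theorem paretoMeasure_absolutelyContinuous (a : ℝ) : paretoMeasure 1 a ≪ volume :=
  withDensity_absolutelyContinuous _ _

theorem paretoMeasure_Ici {a : ℝ} (ha : 0 < a) {x : ℝ} (hx : 1 ≤ x) :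
    paretoMeasure 1 a (Ici x) = ENNReal.ofReal (x ^ (-a)) := by
  rw [← paretoMeasure_Ioi ha hx]
  exact measure_congr ((paretoMeasure_absolutelyContinuous a).ae_eq Ioi_ae_eq_Ici.symm)

theorem ae_one_lt_paretoMeasure {a : ℝ} (ha : 0 < a) : ∀ᵐ z ∂(paretoMeasure 1 a), 1 < z := by
  have := isProbabilityMeasure_paretoMeasure one_pos ha
  exact (prob_compl_eq_zero_iff measurableSet_Ioi).2 (by simp [paretoMeasure_Ioi ha le_rfl])

/-- The density is positive on `(1,∞)`. Almost sure bounds under the Pareto law thus hold Lebesgue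
almost everywhere there. -/
theorem volume_restrict_absolutelyContinuous_paretoMeasure :
    volume.restrict (Ioi (1 : ℝ)) ≪ paretoMeasure 1 1 := by
  refine Measure.AbsolutelyContinuous.mk fun s hs h => ?_
  rw [← lintegral_indicator_one hs, lintegral_paretoMeasure 1 (measurable_one.indicator hs),
    lintegral_eq_zero_iff (by
      have := measurable_one (β := ℝ) (α := ℝ≥0∞) |>.indicator hs
      fun_prop)] at h
  rw [Measure.restrict_apply hs]
  have h2 := (ae_restrict_iff' measurableSet_Ioi).1 h
  refine measure_mono_null ?_ h2
  rintro z ⟨hzs, hz⟩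
  have hz0 : (0 : ℝ) < z := zero_lt_one.trans hz
  have : 0 < (1 : ℝ) * z ^ (-(1 + 1 : ℝ)) := by positivity
  simp only [mem_compl_iff, mem_ofPred_eq, Classical.not_imp]
  refine ⟨hz, ?_⟩
  simp only [Pi.zero_apply, indicator_of_mem hzs, Pi.one_apply, mul_one, ENNReal.ofReal_eq_zero,
    not_le]
  exact this

theorem paretoMeasure_Ici_max {a : ℝ} (ha : 0 < a) (x : ℝ) :
    paretoMeasure 1 a (Ici x) = ENNReal.ofReal ((max x 1) ^ (-a)) := by
  have := isProbabilityMeasure_paretoMeasure one_pos ha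
  rcases le_total 1 x with h | h
  · rw [max_eq_left h, paretoMeasure_Ici ha h]
  · rw [max_eq_right h, Real.one_rpow, ENNReal.ofReal_one]
    refine le_antisymm prob_le_one ?_
    calc (1 : ℝ≥0∞) = paretoMeasure 1 a (Ici 1) := by simp [paretoMeasure_Ici ha le_rfl]
      _ ≤ _ := measure_mono (Ici_subset_Ici.2 h)

/-- Truncation at `1` changes the power only on a null set and makes it monotone on all of `ℝ`, as
the comonotone argument requires. -/
theorem map_rpow_paretoMeasure {γ : ℝ} (hγ : 0 < γ) :
    (paretoMeasure 1 1).map (fun z => (max z 1) ^ γ) = paretoMeasure 1 (1 / γ) := by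
  have hγ' : 0 < 1 / γ := by positivity
  have := isProbabilityMeasure_paretoMeasure one_pos hγ'
  have hm : Measurable fun z : ℝ => (max z 1) ^ γ := by fun_prop
  have := Measure.isProbabilityMeasure_map (μ := paretoMeasure 1 1) hm.aemeasurable
  refine Measure.ext_of_Ici _ _ fun x => ?_
  rw [Measure.map_apply hm measurableSet_Ici, paretoMeasure_Ici_max hγ']
  rcases le_or_gt x 1 with h | h
  · have : (fun z : ℝ => (max z 1) ^ γ) ⁻¹' Ici x = univ := by
      ext z
      simp only [mem_preimage, mem_Ici, mem_univ, iff_true]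
      exact h.trans (Real.one_le_rpow (le_max_right _ _) hγ.le)
    rw [this, max_eq_right h, measure_univ, Real.one_rpow, ENNReal.ofReal_one]
  · have hx0 : 0 < x := by linarith
    have h1 : 1 < x ^ (1 / γ) := Real.one_lt_rpow h hγ'
    have : (fun z : ℝ => (max z 1) ^ γ) ⁻¹' Ici x = Ici (x ^ (1 / γ)) := by
      ext z
      simp only [mem_preimage, mem_Ici]
      have hxx : x = (x ^ (1 / γ)) ^ γ := by
        rw [← Real.rpow_mul hx0.le, one_div_mul_cancel hγ.ne', Real.rpow_one]
      conv_lhs => rw [hxx]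
      rw [Real.rpow_le_rpow_iff (by positivity) (by positivity) hγ, le_max_iff]
      exact or_iff_left (not_le.2 h1)
    rw [this, max_eq_left h.le, paretoMeasure_Ici one_pos h1.le, ← Real.rpow_mul hx0.le]
    congr 2; ring

/-- Multiplicative lack of memory: for `x > t` the conditional tail is `(1/x)/(1/t) = 1/(x/t)`. -/
theorem cond_Ioi_paretoMeasure {t : ℝ} (ht : 1 < t) :
    (paretoMeasure 1 1)[|Ioi t] = (paretoMeasure 1 1).map (fun z => t * z) := by
  have ht0 : 0 < t := by linarith
  have hm : Measurable fun z : ℝ => t * z := by fun_prop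
  have := Measure.isProbabilityMeasure_map (μ := paretoMeasure 1 1) hm.aemeasurable
  have hIoi := paretoMeasure_Ioi one_pos ht.le
  have hne : paretoMeasure 1 1 (Ioi t) ≠ 0 := by
    rw [hIoi, Ne, ENNReal.ofReal_eq_zero, not_le]; positivity
  have := cond_isProbabilityMeasure hne
  refine Measure.ext_of_Ici _ _ fun x => ?_
  rw [Measure.map_apply hm measurableSet_Ici, cond_apply measurableSet_Ioi]
  have h1 : (fun z => t * z) ⁻¹' Ici x = Ici (x / t) := by
    ext z; simp [div_le_iff₀' ht0]
  rw [h1, paretoMeasure_Ici_max one_pos]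
  rcases le_or_gt x t with h | h
  · rw [max_eq_right ((div_le_one ht0).2 h), Real.one_rpow, ENNReal.ofReal_one,
      inter_eq_left.2 (show Ioi t ⊆ Ici x from fun z hz => h.trans (le_of_lt hz)), ENNReal.inv_mul_cancel hne
      (measure_ne_top _ _)]
  · rw [max_eq_left ((one_le_div ht0).2 h.le), inter_eq_right.2 (show Ici x ⊆ Ioi t from fun z hz => h.trans_le hz), hIoi,
      paretoMeasure_Ici one_pos (by linarith), ← ENNReal.ofReal_inv_of_pos (by positivity),
      ← ENNReal.ofReal_mul (by positivity), Real.rpow_neg_one, Real.rpow_neg_one,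
      Real.rpow_neg_one, inv_inv]
    congr 1
    field_simp

end Pareto

/-! ### Transfer to the logarithmic half-line -/

namespace LogHalfLine

theorem measurableEmbedding_val : MeasurableEmbedding LogHalfLine.val :=
  MeasurableEmbedding.subtype_coe (measurableSet_Ici (a := (1 : ℝ)))

theorem ofReal_map_val {S : Type*} [MeasurableSpace S] (m : Measure S) {F : S → LogHalfLine}
    (hF : Measurable F) : ofReal (m.map fun z => (F z).val) = m.map F := by
  have h : (m.map fun z => (F z).val) = (m.map F).map LogHalfLine.val :=
    (Measure.map_map measurableEmbedding_val.measurable hF).symm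
  rw [h, ofReal, measurableEmbedding_val.comap_map]

theorem measurable_log_val : Measurable fun x : LogHalfLine => Real.log x.val :=
  Real.measurable_log.comp measurableEmbedding_val.measurable

end LogHalfLine

/-- The Wasserstein distance between two comonotone images of a law on the line. -/
theorem wasserstein_map_of_monotone {lam : Measure ℝ} [IsFiniteMeasure lam]
    {F G : ℝ → LogHalfLine} (hF : Measurable F) (hG : Measurable G)
    (hF' : Monotone fun z => Real.log (F z).val) (hG' : Monotone fun z => Real.log (G z).val)
    {p : ℝ≥0∞} (hp : 1 ≤ p) :
    wasserstein p (lam.map F) (lam.map G)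
      = eLpNorm (fun z => Real.log (F z).val - Real.log (G z).val) p lam := by
  have hl := LogHalfLine.measurable_log_val
  have hdist : ∀ π : Measure (LogHalfLine × LogHalfLine),
      eLpNorm (fun z : LogHalfLine × LogHalfLine => dist z.1 z.2) p π
        = eLpNorm (fun z => Real.log z.1.val - Real.log z.2.val) p π := fun π => by
    refine eLpNorm_congr_norm_ae (ae_of_all _ fun z => ?_)
    rw [LogHalfLine.dist_eq, Real.norm_eq_abs, Real.norm_eq_abs, abs_abs]
  refine le_antisymm ?_ ?_
  · refine iInf₂_le_of_le (lam.map fun z => (F z, G z)) ⟨?_, ?_⟩ ?_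
    · rw [Measure.map_map measurable_fst (hF.prodMk hG)]; rfl
    · rw [Measure.map_map measurable_snd (hF.prodMk hG)]; rfl
    · have hm : Measurable fun z : LogHalfLine × LogHalfLine =>
          Real.log z.1.val - Real.log z.2.val :=
        (hl.comp measurable_fst).sub (hl.comp measurable_snd)
      rw [hdist, eLpNorm_map_measure hm.aestronglyMeasurable (hF.prodMk hG).aemeasurable]
      exact le_rfl
  · refine le_iInf₂ fun π hπ => ?_
    rw [hdist]
    -- The infimum runs over arbitrary measures; the finiteness needed for Tonelli comes from the
    -- first marginal.
    have hfin : IsFiniteMeasure π := by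
      have h1 : IsFiniteMeasure (π.map Prod.fst) := by
        rw [hπ.1]; infer_instance
      exact Measure.isFiniteMeasure_of_map measurable_fst.aemeasurable
    have hm1 : Measurable fun z : LogHalfLine × LogHalfLine => Real.log z.1.val :=
      hl.comp measurable_fst
    have hm2 : Measurable fun z : LogHalfLine × LogHalfLine => Real.log z.2.val :=
      hl.comp measurable_snd
    have h1 : π.map (fun z => Real.log z.1.val) = lam.map fun z => Real.log (F z).val := by
      have e1 : π.map (fun z => Real.log z.1.val)
          = (π.map Prod.fst).map fun x : LogHalfLine => Real.log x.val :=
        (Measure.map_map hl measurable_fst).symm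
      rw [e1, hπ.1]
      exact Measure.map_map hl hF
    have h2 : π.map (fun z => Real.log z.2.val) = lam.map fun z => Real.log (G z).val := by
      have e1 : π.map (fun z => Real.log z.2.val)
          = (π.map Prod.snd).map fun x : LogHalfLine => Real.log x.val :=
        (Measure.map_map hl measurable_snd).symm
      rw [e1, hπ.2]
      exact Measure.map_map hl hG
    exact eLpNorm_sub_le_of_comonotone hF' hG' hm1 hm2 h1 h2 hp

/-! ### The exceedance law and the formula for its distance to the Pareto law -/

theorem exceedanceLaw_eq {Ω : Type*} [MeasurableSpace Ω] {Pr : Measure Ω}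
    {X Z : Ω → ℝ} (hZ : AEMeasurable Z Pr)
    (hPZ : Pr.map Z = paretoMeasure 1 1) {U : ℝ → ℝ} (hX : X =ᵐ[Pr] fun ω => U (Z ω))
    {t : ℝ} (ht : 1 < t) (hU : MonotoneOn U (Ici t)) :
    exceedanceLaw Pr X Z U t
      = (paretoMeasure 1 1).map fun z => (U t)⁻¹ * U (t * max z 1) := by
  have ht0 : 0 < t := by linarith
  -- `U` is controlled only on `[t,∞)`; the truncated version is monotone everywhere, hence
  -- measurable, and agrees with `U` on `Z > t`.
  have hmono : Monotone fun z => U (max z t) := fun a b hab =>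
    hU (show t ≤ max a t from le_max_right _ _) (show t ≤ max b t from le_max_right _ _)
      (max_le_max_right _ hab)
  have hh : Measurable fun z => (U t)⁻¹ * U (max z t) := hmono.measurable.const_mul _
  have hac : Pr[|{ω | t < Z ω}] ≪ Pr := cond_absolutelyContinuous
  have hnull : NullMeasurableSet {ω | t < Z ω} Pr := nullMeasurableSet_lt aemeasurable_const hZ
  have hmem : ∀ᵐ ω ∂(Pr[|{ω | t < Z ω}]), t < Z ω := by
    refine Measure.ae_smul_measure ?_ _
    exact ae_restrict_mem₀ hnull
  have hZlaw : (Pr[|{ω | t < Z ω}]).map Z = (paretoMeasure 1 1).map fun z => t * z := by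
    rw [← cond_Ioi_paretoMeasure ht, ← hPZ, ProbabilityTheory.cond, ProbabilityTheory.cond,
      Measure.map_smul, Measure.restrict_map_of_aemeasurable hZ measurableSet_Ioi,
      Measure.map_apply_of_aemeasurable hZ measurableSet_Ioi]
    rfl
  have hae : (fun ω => (U t)⁻¹ * X ω) =ᵐ[Pr[|{ω | t < Z ω}]]
      (fun z => (U t)⁻¹ * U (max z t)) ∘ Z := by
    filter_upwards [hac.ae_le hX, hmem] with ω h1 h2
    simp only [Function.comp_apply]
    rw [h1, max_eq_left h2.le]
  rw [exceedanceLaw, Measure.map_congr hae,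
    ← AEMeasurable.map_map_of_aemeasurable hh.aemeasurable (hZ.mono_ac hac), hZlaw,
    Measure.map_map hh (by fun_prop)]
  congr 1
  funext z
  simp only [Function.comp_apply]
  rw [mul_max_of_nonneg _ _ ht0.le, mul_one]

/-- `A_p` as an `L^p` norm with respect to the standard Pareto law. -/
theorem Ap_eq_eLpNorm {U : ℝ → ℝ} (γ : ℝ) {p : ℝ≥0∞} (hp : 1 ≤ p) {t : ℝ} (ht : 0 < t)
    (hU : MonotoneOn U (Ici t)) (hpos : 0 < U t)
    (hcont : ∀ s, t < s → ContinuousWithinAt U (Iio s) s) :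
    Ap U γ p t = eLpNorm (fun z => Real.log ((U t)⁻¹ * U (t * max z 1))
      - Real.log ((max z 1) ^ γ)) p (paretoMeasure 1 1) := by
  have hmono : Monotone fun z => U (t * max z 1) := fun a b hab =>
    hU (le_mul_of_one_le_right ht.le (le_max_right _ _))
      (le_mul_of_one_le_right ht.le (le_max_right _ _))
      (mul_le_mul_of_nonneg_left (max_le_max_right _ hab) ht.le)
  have hmeas : Measurable fun z => Real.log ((U t)⁻¹ * U (t * max z 1))
      - Real.log ((max z 1) ^ γ) := by
    exact (Real.measurable_log.comp (hmono.measurable.const_mul _)).sub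
      (Real.measurable_log.comp (by fun_prop))
  have hpt : ∀ z, 1 < z → Real.log (U (z * t) / (z ^ γ * U t))
      = Real.log ((U t)⁻¹ * U (t * max z 1)) - Real.log ((max z 1) ^ γ) := by
    intro z hz
    have hz0 : 0 < z := by linarith
    have hUz : 0 < U (t * z) := hpos.trans_le
      (hU self_mem_Ici (le_mul_of_one_le_right ht.le hz.le) (le_mul_of_one_le_right ht.le hz.le))
    have hzγ : 0 < z ^ γ := by positivity
    rw [max_eq_left hz.le, ← Real.log_div (by positivity) (by positivity), mul_comm z t]
    congr 1
    field_simp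
  by_cases htop : p = ∞
  · subst htop
    rw [Ap, if_pos rfl, eLpNorm_exponent_top]
    refine le_antisymm (iSup₂_le fun z hz => ?_) (essSup_le_of_ae_le _ ?_)
    · rw [hpt z hz, ← Real.enorm_eq_ofReal_abs]
      -- A value above the essential supremum at `z` would, by left continuity, persist on some `(a,
      -- z)`, a set of positive Lebesgue measure.
      by_contra hlt
      rw [not_le] at hlt
      have hz0 : 0 < z := zero_lt_one.trans hz
      have hUz : 0 < U (t * max z 1) := hpos.trans_le
        (hU self_mem_Ici (le_mul_of_one_le_right ht.le (le_max_right _ _))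
          (le_mul_of_one_le_right ht.le (le_max_right _ _)))
      have hcU : ContinuousWithinAt (fun z => U (t * max z 1)) (Iio z) z := by
        have h1 : Tendsto (fun z' => t * max z' 1) (𝓝[<] z) (𝓝[<] (t * max z 1)) := by
          refine tendsto_nhdsWithin_iff.2 ⟨?_, ?_⟩
          · exact (Continuous.tendsto (by fun_prop) z).mono_left nhdsWithin_le_nhds
          · filter_upwards [self_mem_nhdsWithin] with z' hz'
            have h2 : max z' 1 < max z 1 := by
              rw [max_eq_left (le_of_lt (show 1 < z from hz))]; exact max_lt hz' hz
            exact mul_lt_mul_of_pos_left h2 ht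
        refine Tendsto.comp ?_ h1
        refine hcont _ ?_
        rw [max_eq_left (le_of_lt hz)]
        exact lt_mul_of_one_lt_right ht hz
      have hcL : ContinuousWithinAt (fun z => ‖Real.log ((U t)⁻¹ * U (t * max z 1))
          - Real.log ((max z 1) ^ γ)‖ₑ) (Iio z) z := by
        refine ContinuousWithinAt.enorm (ContinuousWithinAt.sub ?_ ?_)
        · exact (continuousWithinAt_const.mul hcU).log (mul_pos (inv_pos.2 hpos) hUz).ne'
        · have hm1 : 0 < max z 1 := by positivity
          have hc : ContinuousAt (fun z : ℝ => (max z 1) ^ γ) z :=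
            ContinuousAt.rpow_const (by fun_prop) (Or.inl hm1.ne')
          exact (hc.log (Real.rpow_pos_of_pos hm1 γ).ne').continuousWithinAt
      have hev := hcL.tendsto.eventually (lt_mem_nhds hlt)
      have hev2 : ∀ᶠ z' in 𝓝[<] z, 1 < z' :=
        eventually_nhdsWithin_of_eventually_nhds (lt_mem_nhds hz)
      obtain ⟨a, ha, hsub⟩ := (mem_nhdsLT_iff_exists_Ioo_subset).1 (hev.and hev2)
      have hae := volume_restrict_absolutelyContinuous_paretoMeasure.ae_le
        (ae_le_eLpNormEssSup (μ := paretoMeasure 1 1)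
          (f := fun z => Real.log ((U t)⁻¹ * U (t * max z 1)) - Real.log ((max z 1) ^ γ)))
      replace hae := (ae_restrict_iff' measurableSet_Ioi).1 hae
      have h0 : volume (Ioo a z) = 0 := by
        refine measure_mono_null (fun z' hz' => ?_) hae
        have := hsub hz'
        simp only [mem_compl_iff, mem_ofPred_eq, Classical.not_imp]
        exact ⟨this.2, not_le.2 this.1⟩
      rw [Real.volume_Ioo, ENNReal.ofReal_eq_zero] at h0
      have : a < z := ha
      linarith
    · filter_upwards [ae_one_lt_paretoMeasure one_pos] with z hz
      rw [← hpt z hz, Real.enorm_eq_ofReal_abs]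
      exact le_iSup₂ (f := fun z (_ : z ∈ Ioi (1 : ℝ)) =>
        ENNReal.ofReal |Real.log (U (z * t) / (z ^ γ * U t))|) z hz
  · have hp0 : p ≠ 0 := (zero_lt_one.trans_le hp).ne'
    rw [Ap, if_neg htop, eLpNorm_eq_lintegral_rpow_enorm_toReal hp0 htop,
      lintegral_paretoMeasure 1 (hmeas.enorm.pow_const _)]
    congr 1
    refine setLIntegral_congr_fun measurableSet_Ioi fun z hz => ?_
    have hz0 : (0 : ℝ) < z := zero_lt_one.trans hz
    rw [hpt z hz, Real.enorm_eq_ofReal_abs,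
      ENNReal.ofReal_rpow_of_nonneg (abs_nonneg _) ENNReal.toReal_nonneg,
      ← ENNReal.ofReal_mul (by positivity)]
    congr 1
    rw [one_mul, show -(1 + 1 : ℝ) = -(2 : ℕ) by norm_num, Real.rpow_neg hz0.le,
      Real.rpow_natCast]
    ring

theorem wasserstein_exceedanceLaw (μ : Measure ℝ) {γ : ℝ} (hγ : 0 < γ)
    {p : ℝ≥0∞} (hp : 1 ≤ p) {Ω : Type*} [MeasurableSpace Ω] (Pr : Measure Ω)
    {X Z : Ω → ℝ} (hZ : AEMeasurable Z Pr) (hPZ : Pr.map Z = paretoMeasure 1 1)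
    (hX : X =ᵐ[Pr] fun ω => tailQuantile μ (Z ω)) {t : ℝ} (ht : 1 < t)
    (hpos : 0 < tailQuantile μ t) :
    wasserstein p (LogHalfLine.ofReal (exceedanceLaw Pr X Z (tailQuantile μ) t))
        (LogHalfLine.ofReal (paretoMeasure 1 (1 / γ)))
      = Ap (tailQuantile μ) γ p t := by
  set U := tailQuantile μ with hUdef
  have ht0 : 0 < t := by linarith
  have hU : MonotoneOn U (Ici t) := (monotoneOn_tailQuantile μ).mono fun s hs => ht.trans_le hs
  have hmono : Monotone fun z => U (t * max z 1) := fun a b hab =>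
    hU (le_mul_of_one_le_right ht0.le (le_max_right _ _))
      (le_mul_of_one_le_right ht0.le (le_max_right _ _))
      (mul_le_mul_of_nonneg_left (max_le_max_right _ hab) ht0.le)
  have hUge : ∀ z, U t ≤ U (t * max z 1) := fun z =>
    hU self_mem_Ici (le_mul_of_one_le_right ht0.le (le_max_right _ _))
      (le_mul_of_one_le_right ht0.le (le_max_right _ _))
  have hF1 : ∀ z, (U t)⁻¹ * U (t * max z 1) ∈ Ici (1 : ℝ) := fun z => by
    rw [mem_Ici, ← div_eq_inv_mul, one_le_div hpos]; exact hUge z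
  have hG1 : ∀ z : ℝ, (max z 1) ^ γ ∈ Ici (1 : ℝ) := fun z =>
    Real.one_le_rpow (le_max_right _ _) hγ.le
  let F : ℝ → LogHalfLine := fun z => ⟨_, hF1 z⟩
  let G : ℝ → LogHalfLine := fun z => ⟨_, hG1 z⟩
  have hF : Measurable F := (hmono.measurable.const_mul _).subtype_mk
  have hG : Measurable G :=
    (show Measurable fun z : ℝ => (max z 1) ^ γ by fun_prop).subtype_mk
  have e1 : LogHalfLine.ofReal (exceedanceLaw Pr X Z U t) = (paretoMeasure 1 1).map F := by
    rw [exceedanceLaw_eq hZ hPZ hX ht hU]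
    exact LogHalfLine.ofReal_map_val _ hF
  have e2 : LogHalfLine.ofReal (paretoMeasure 1 (1 / γ)) = (paretoMeasure 1 1).map G := by
    rw [← map_rpow_paretoMeasure hγ]
    exact LogHalfLine.ofReal_map_val _ hG
  rw [e1, e2, wasserstein_map_of_monotone hF hG ?_ ?_ hp,
    Ap_eq_eLpNorm γ hp ht0 hU hpos fun s hs => continuousWithinAt_tailQuantile μ (ht.trans hs)]
  · rfl
  · exact fun a b hab => Real.log_le_log (zero_lt_one.trans_le (hF1 a))
      (mul_le_mul_of_nonneg_left (hmono hab) (by positivity))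
  · exact fun a b hab => Real.log_le_log (zero_lt_one.trans_le (hG1 a))
      (Real.rpow_le_rpow (by positivity) (max_le_max_right _ hab) hγ.le)

/-! ### From the domain of attraction to increments of the tail quantile function -/

section DomainOfAttraction

variable {μ : Measure ℝ} {γ : ℝ} {a b : ℕ → ℝ}

theorem tendsto_one_sub_one_div_mul_pow {y : ℝ} :
    Tendsto (fun n : ℕ => (1 - 1 / (n * y)) ^ n) atTop (𝓝 (Real.exp (-(1 / y)))) := by
  refine (Real.tendsto_one_add_div_pow_exp (-(1 / y))).congr fun n => ?_
  congr 1
  rw [neg_div, div_div, mul_comm y, sub_eq_add_neg]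

theorem gevCDF_of_pos (hγ : 0 < γ) {x : ℝ} (hx : 0 < 1 + γ * x) :
    gevCDF γ x = Real.exp (-(1 + γ * x) ^ (-1 / γ)) := by
  rw [gevCDF, if_neg hγ.ne', if_pos hx]

theorem rpow_neg_one_div_rpow (hγ : 0 < γ) {y : ℝ} (hy : 0 < y) :
    (y ^ γ) ^ (-1 / γ) = 1 / y := by
  rw [← Real.rpow_mul hy.le, mul_div_cancel₀ _ hγ.ne', Real.rpow_neg_one, one_div]

/-- Since `(1 - 1/(ny))^n → exp(-1/y)`, a strict inequality between this limit and `G_γ(x)`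
eventually compares `1 - 1/(ny)` with `F(a_n x + b_n)`, hence `U(ny)` with `a_n x + b_n`. The two
limits agree exactly at `x = (y^γ - 1)/γ`. -/
theorem tendsto_tailQuantile_nat (hγ : 0 < γ) (ha : ∀ n, 0 < a n)
    (hlim : ∀ x : ℝ, Tendsto (fun n : ℕ => (cdf μ (a n * x + b n)) ^ n) atTop
      (𝓝 (gevCDF γ x))) {y : ℝ} (hy : 0 < y) :
    Tendsto (fun n : ℕ => (tailQuantile μ (n * y) - b n) / a n) atTop
      (𝓝 ((y ^ γ - 1) / γ)) := by
  have hyγ : 0 < y ^ γ := by positivity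
  have hlarge : ∀ᶠ n : ℕ in atTop, 1 < n * y :=
    (tendsto_natCast_atTop_atTop.atTop_mul_const hy).eventually (eventually_gt_atTop 1)
  have hD : 1 + γ * ((y ^ γ - 1) / γ) = y ^ γ := by field_simp; ring
  refine tendsto_order.2 ⟨fun d hd => ?_, fun d hd => ?_⟩
  -- The comparison point `x` must stay above `-1/γ`, the left endpoint of `G_γ`.
  · have h1 : -1 / γ < (y ^ γ - 1) / γ := by gcongr; linarith
    obtain ⟨x, hx1, hx2⟩ := exists_between (max_lt hd h1)
    have hx0 : 0 < 1 + γ * x := by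
      have := (le_max_right _ _).trans_lt hx1
      rw [div_lt_iff₀ hγ] at this
      linarith
    have hG : gevCDF γ x < Real.exp (-(1 / y)) := by
      rw [gevCDF_of_pos hγ hx0, Real.exp_lt_exp, neg_lt_neg_iff, ← rpow_neg_one_div_rpow hγ hy]
      refine Real.rpow_lt_rpow_of_neg hx0 ?_ (div_neg_of_neg_of_pos (by norm_num) hγ)
      rw [← hD]; gcongr
    filter_upwards [(hlim x).eventually_lt tendsto_one_sub_one_div_mul_pow hG, hlarge]
      with n hn hn1
    have h2 := lt_of_pow_lt_pow_left₀ n (one_sub_one_div_mem_Ioo hn1).1.le hn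
    have h3 := le_tailQuantile μ hn1 h2
    refine ((le_max_left _ _).trans_lt hx1).trans_le ?_
    rw [le_div_iff₀ (ha n)]
    linarith
  · obtain ⟨x, hx1, hx2⟩ := exists_between hd
    have hxy : y ^ γ < 1 + γ * x := by rw [← hD]; gcongr
    have hx0 : 0 < 1 + γ * x := hyγ.trans hxy
    have hG : Real.exp (-(1 / y)) < gevCDF γ x := by
      rw [gevCDF_of_pos hγ hx0, Real.exp_lt_exp, neg_lt_neg_iff, ← rpow_neg_one_div_rpow hγ hy]
      exact Real.rpow_lt_rpow_of_neg hyγ hxy (div_neg_of_neg_of_pos (by norm_num) hγ)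
    filter_upwards [tendsto_one_sub_one_div_mul_pow.eventually_lt (hlim x) hG, hlarge]
      with n hn hn1
    have h2 := lt_of_pow_lt_pow_left₀ n (cdf_nonneg μ _) hn
    have h3 := tailQuantile_le μ hn1 h2.le
    refine lt_of_le_of_lt ?_ hx2
    rw [div_le_iff₀ (ha n)]
    linarith

/-- Monotonicity and `⌊t⌋ y ≤ t y ≤ ⌊t⌋ y'`, for any `y' > y` and large `t`, reduce to integers;
continuity of the limit in `y` lets `y'` be close to `y`. -/
theorem tendsto_tailQuantile_floor (hγ : 0 < γ) (ha : ∀ n, 0 < a n)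
    (hlim : ∀ x : ℝ, Tendsto (fun n : ℕ => (cdf μ (a n * x + b n)) ^ n) atTop
      (𝓝 (gevCDF γ x))) {y : ℝ} (hy : 0 < y) :
    Tendsto (fun t : ℝ => (tailQuantile μ (t * y) - b ⌊t⌋₊) / a ⌊t⌋₊) atTop
      (𝓝 ((y ^ γ - 1) / γ)) := by
  have hfl : Tendsto (fun t : ℝ => ⌊t⌋₊) atTop atTop := tendsto_nat_floor_atTop
  have hlarge : ∀ᶠ n : ℕ in atTop, 1 < n * y :=
    (tendsto_natCast_atTop_atTop.atTop_mul_const hy).eventually (eventually_gt_atTop 1)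
  refine tendsto_order.2 ⟨fun d hd => ?_, fun d hd => ?_⟩
  · have h1 := hfl.eventually
      ((tendsto_tailQuantile_nat hγ ha hlim hy).eventually (lt_mem_nhds hd))
    filter_upwards [h1, hfl.eventually hlarge, eventually_ge_atTop 0] with t ht1 ht2 ht3
    refine ht1.trans_le ?_
    have hle : (⌊t⌋₊ : ℝ) * y ≤ t * y := by gcongr; exact Nat.floor_le ht3
    have := monotoneOn_tailQuantile μ ht2 (ht2.trans_le hle) hle
    have := (ha ⌊t⌋₊).le
    gcongr
  · have hc : ContinuousAt (fun y : ℝ => (y ^ γ - 1) / γ) y :=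
      ((Real.continuousAt_rpow_const _ _ (Or.inl hy.ne')).sub continuousAt_const).div_const _
    obtain ⟨y', hy'1, hy'2⟩ : ∃ y', (y' ^ γ - 1) / γ < d ∧ y < y' :=
      (((hc.tendsto.eventually (gt_mem_nhds hd)).filter_mono nhdsWithin_le_nhds).and
        (self_mem_nhdsWithin (s := Ioi y))).exists
    have h1 := hfl.eventually
      ((tendsto_tailQuantile_nat hγ ha hlim (hy.trans hy'2)).eventually (gt_mem_nhds hy'1))
    have h2 : ∀ᶠ n : ℕ in atTop, y ≤ n * (y' - y) :=
      (tendsto_natCast_atTop_atTop.atTop_mul_const (sub_pos.2 hy'2)).eventually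
        (eventually_ge_atTop y)
    filter_upwards [h1, hfl.eventually hlarge, eventually_ge_atTop 0, hfl.eventually h2]
      with t ht1 ht2 ht3 ht4
    refine lt_of_le_of_lt ?_ ht1
    have hle0 : (⌊t⌋₊ : ℝ) * y ≤ t * y := by gcongr; exact Nat.floor_le ht3
    have hle : t * y ≤ ⌊t⌋₊ * y' := by
      have : t * y ≤ (⌊t⌋₊ + 1) * y := by gcongr; exact (Nat.lt_floor_add_one t).le
      nlinarith
    have h1 := ht2.trans_le hle0
    have := monotoneOn_tailQuantile μ h1 (h1.trans_le hle) hle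
    have := (ha ⌊t⌋₊).le
    gcongr

theorem tendsto_increment_ratio_of_inDomainOfAttraction (hγ : 0 < γ)
    (h : InDomainOfAttraction μ γ) {y : ℝ} (hy : 1 < y) :
    (∀ᶠ t in atTop, 0 < tailQuantile μ (t * y) - tailQuantile μ t) ∧
    Tendsto (fun t => (tailQuantile μ (t * y * y) - tailQuantile μ (t * y)) /
      (tailQuantile μ (t * y) - tailQuantile μ t)) atTop (𝓝 (y ^ γ)) := by
  obtain ⟨a, b, ha, hlim⟩ := h
  have hy0 : 0 < y := by linarith
  have h0 := tendsto_tailQuantile_floor hγ ha hlim one_pos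
  have h1 := tendsto_tailQuantile_floor hγ ha hlim hy0
  have h2 := tendsto_tailQuantile_floor hγ ha hlim (mul_pos hy0 hy0)
  have hyγ : 1 < y ^ γ := Real.one_lt_rpow hy hγ
  have hD : 0 < (y ^ γ - 1) / γ := div_pos (by linarith) hγ
  have e1 : Tendsto (fun t : ℝ => (tailQuantile μ (t * y) - tailQuantile μ t) / a ⌊t⌋₊) atTop
      (𝓝 ((y ^ γ - 1) / γ)) := by
    have := h1.sub h0
    simp only [Real.one_rpow, sub_self, zero_div, sub_zero, mul_one] at this
    refine this.congr fun t => ?_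
    rw [← sub_div]; congr 1; ring
  have e2 : Tendsto (fun t : ℝ => (tailQuantile μ (t * y * y) - tailQuantile μ (t * y)) /
      a ⌊t⌋₊) atTop (𝓝 (y ^ γ * ((y ^ γ - 1) / γ))) := by
    have := h2.sub h1
    rw [Real.mul_rpow hy0.le hy0.le] at this
    convert this using 2 with t
    · rw [← sub_div, mul_assoc]; congr 1; ring
    · field_simp; ring
  refine ⟨?_, ?_⟩
  · filter_upwards [e1.eventually (lt_mem_nhds hD)] with t ht
    exact (div_pos_iff_of_pos_right (ha _)).1 ht
  · have := e2.div e1 hD.ne'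
    rw [mul_div_cancel_right₀ _ hD.ne'] at this
    refine this.congr fun t => ?_
    exact div_div_div_cancel_right₀ (ha _).ne' _ _

end DomainOfAttraction

/-! ### From increment ratios to regular variation -/

theorem forall_ge_of_mul_step {P : ℝ → Prop} {y T : ℝ} (hy : 1 < y) (hT : 0 < T)
    (base : ∀ t, T ≤ t → t ≤ T * y → P t) (step : ∀ t, T ≤ t → P t → P (t * y)) :
    ∀ t, T ≤ t → P t := by
  have hy0 : 0 < y := by linarith
  have key : ∀ k : ℕ, ∀ t, T ≤ t → t ≤ T * y ^ (k + 1) → P t := by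
    intro k
    induction k with
    | zero => simpa using base
    | succ k ih =>
      intro t h1 h2
      rcases le_total t (T * y) with h | h
      · exact base t h1 h
      · have h3 : T ≤ t / y := by rwa [le_div_iff₀ hy0]
        have h4 : t / y ≤ T * y ^ (k + 1) := by
          rw [div_le_iff₀ hy0, mul_assoc, ← pow_succ]; exact h2
        have := step _ h3 (ih _ h3 h4)
        rwa [div_mul_cancel₀ _ hy0.ne'] at this
  intro t ht
  obtain ⟨n, hn⟩ := pow_unbounded_of_one_lt (t / T) hy
  refine key n t ht ?_
  rw [div_lt_iff₀ hT] at hn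
  have : y ^ n ≤ y ^ (n + 1) := pow_le_pow_right₀ hy.le (Nat.le_succ n)
  nlinarith

/-- As `q > 1`, the increments along `T y^k` are eventually nondecreasing and positive, so `U(T
y^k)` grows at least linearly in `k`. -/
theorem tendsto_atTop_of_increment_ratio {U : ℝ → ℝ} {c y q : ℝ} (hU : MonotoneOn U (Ioi c))
    (hy : 1 < y) (hq : 1 < q) (hpos : ∀ᶠ t in atTop, 0 < U (t * y) - U t)
    (hlim : Tendsto (fun t => (U (t * y * y) - U (t * y)) / (U (t * y) - U t)) atTop (𝓝 q)) :
    Tendsto U atTop atTop := by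
  obtain ⟨T, hT⟩ := eventually_atTop.1 ((hpos.and (hlim.eventually (lt_mem_nhds hq))).and
    (eventually_gt_atTop (max c 0)))
  have hTc := (hT T le_rfl).2
  have hT0 : 0 < T := (le_max_right _ _).trans_lt hTc
  have hstep : ∀ t, T ≤ t → U (t * y) - U t ≤ U (t * y * y) - U (t * y) := fun t ht => by
    have := (hT t ht).1
    have h2 := (one_lt_div this.1).1 this.2
    exact h2.le
  have hk : ∀ k : ℕ, T ≤ T * y ^ k ∧ U (T * y) - U T ≤ U (T * y ^ k * y) - U (T * y ^ k) ∧
      U T + k * (U (T * y) - U T) ≤ U (T * y ^ k) := by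
    intro k
    induction k with
    | zero => simp
    | succ k ih =>
      have e : T * y ^ (k + 1) = T * y ^ k * y := by ring
      refine ⟨le_mul_of_one_le_right hT0.le (one_le_pow₀ hy.le), ?_, ?_⟩
      · rw [e]; exact ih.2.1.trans (hstep _ ih.1)
      · rw [e]; push_cast; linarith [ih.2.1, ih.2.2]
  have hd : 0 < U (T * y) - U T := (hT T le_rfl).1.1
  refine tendsto_atTop.2 fun C => ?_
  obtain ⟨k, hkC⟩ := exists_nat_ge ((C - U T) / (U (T * y) - U T))
  rw [div_le_iff₀ hd] at hkC
  filter_upwards [eventually_ge_atTop (T * y ^ k)] with t ht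
  have h1 : c < T * y ^ k := ((le_max_left _ _).trans_lt hTc).trans_le (hk k).1
  have := hU h1 (h1.trans_le ht) ht
  linarith [(hk k).2.2]

/-- A Stolz–Cesàro argument. For `q' < q`, the quantity `U(ty) - q' U(t)` eventually does not
decrease under `t ↦ ty`, so it is bounded below; division by `U(t) → ∞` gives the lower bound for
the ratio. The case `q' > q` is symmetric. -/
theorem tendsto_ratio_of_increment_ratio {U : ℝ → ℝ} {c y q : ℝ} (hU : MonotoneOn U (Ioi c))
    (hy : 1 < y) (hq : 1 < q) (hpos : ∀ᶠ t in atTop, 0 < U (t * y) - U t)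
    (hlim : Tendsto (fun t => (U (t * y * y) - U (t * y)) / (U (t * y) - U t)) atTop (𝓝 q)) :
    Tendsto (fun t => U (t * y) / U t) atTop (𝓝 q) := by
  have hinf := tendsto_atTop_of_increment_ratio hU hy hq hpos hlim
  have hy0 : 0 < y := by linarith
  have hzero : ∀ C : ℝ, Tendsto (fun t => C / U t) atTop (𝓝 0) := fun C =>
    hinf.const_div_atTop C
  refine tendsto_order.2 ⟨fun e he => ?_, fun e he => ?_⟩
  · obtain ⟨q', hq', hq'q⟩ := exists_between (max_lt he (zero_lt_one.trans hq))
    have hq'0 : 0 < q' := (le_max_right _ _).trans_lt hq'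
    obtain ⟨T, hT⟩ := eventually_atTop.1 ((hpos.and (hlim.eventually (lt_mem_nhds hq'q))).and
      (eventually_gt_atTop (max c 0)))
    have hTc := (hT T le_rfl).2
    have hT0 : 0 < T := (le_max_right _ _).trans_lt hTc
    have hc : ∀ {t}, T ≤ t → t ∈ Ioi c := fun ht => ((le_max_left _ _).trans_lt hTc).trans_le ht
    have key := forall_ge_of_mul_step
      (P := fun t => U (T * y) - q' * U (T * y) ≤ U (t * y) - q' * U t) hy hT0 ?_ ?_
    · filter_upwards [hinf.eventually (eventually_gt_atTop 0), eventually_ge_atTop T,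
        (hzero (U (T * y) - q' * U (T * y))).eventually
          (lt_mem_nhds (show e - q' < 0 by linarith [le_max_left e 0]))] with t h1 h2 h3
      have := key t h2
      rw [lt_div_iff₀ h1] at h3 ⊢
      linarith
    · intro t h1 h2
      have hTy : T ≤ T * y := le_mul_of_one_le_right hT0.le hy.le
      have i1 := hU (hc h1) (hc hTy) h2
      have i2 := hU (hc hTy) (hc (h1.trans (le_mul_of_one_le_right (hT0.le.trans h1) hy.le)))
        (mul_le_mul_of_nonneg_right h1 hy0.le)
      have := mul_le_mul_of_nonneg_left i1 hq'0.le
      linarith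
    · intro t h1 h2
      have := (hT t h1).1
      have h3 := (lt_div_iff₀ this.1).1 this.2
      linarith
  · obtain ⟨q', hqq', hq'⟩ := exists_between he
    have hq'0 : 0 < q' := by linarith
    obtain ⟨T, hT⟩ := eventually_atTop.1 ((hpos.and (hlim.eventually (gt_mem_nhds hqq'))).and
      (eventually_gt_atTop (max c 0)))
    have hTc := (hT T le_rfl).2
    have hT0 : 0 < T := (le_max_right _ _).trans_lt hTc
    have hc : ∀ {t}, T ≤ t → t ∈ Ioi c := fun ht => ((le_max_left _ _).trans_lt hTc).trans_le ht
    have key := forall_ge_of_mul_step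
      (P := fun t => U (t * y) - q' * U t ≤ U (T * y * y) - q' * U T) hy hT0 ?_ ?_
    · filter_upwards [hinf.eventually (eventually_gt_atTop 0), eventually_ge_atTop T,
        (hzero (U (T * y * y) - q' * U T)).eventually
          (gt_mem_nhds (show 0 < e - q' by linarith))] with t h1 h2 h3
      have := key t h2
      rw [div_lt_iff₀ h1] at h3 ⊢
      linarith
    · intro t h1 h2
      have hty : T ≤ t * y := h1.trans (le_mul_of_one_le_right (hT0.le.trans h1) hy.le)
      have hle : t * y ≤ T * y * y := mul_le_mul_of_nonneg_right h2 hy0.le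
      have i1 := hU (hc le_rfl) (hc h1) h1
      have i2 := hU (hc hty) (hc (hty.trans hle)) hle
      have := mul_le_mul_of_nonneg_left i1 hq'0.le
      linarith
    · intro t h1 h2
      have := (hT t h1).1
      have h3 := (div_lt_iff₀ this.1).1 this.2
      linarith

/-- The quantile-side first-order condition: `U` is regularly varying with index `γ`. -/
theorem tendsto_tailQuantile_ratio {μ : Measure ℝ} {γ : ℝ} (hγ : 0 < γ)
    (h : InDomainOfAttraction μ γ) {y : ℝ} (hy : 1 < y) :
    Tendsto (fun t => tailQuantile μ (t * y) / tailQuantile μ t) atTop (𝓝 (y ^ γ)) := by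
  have := tendsto_increment_ratio_of_inDomainOfAttraction hγ h hy
  exact tendsto_ratio_of_increment_ratio (monotoneOn_tailQuantile μ) hy
    (Real.one_lt_rpow hy hγ) this.1 this.2

/-! ### Dominated convergence and a first-order Potter bound -/

section Domination

/-- The exponent `1/(2p)` becomes `1/2` after the `p`-th power, leaving the integrable `z^(-3/2)`.
-/
theorem lintegral_rpow_div_sq_lt_top {C p : ℝ} (hC : 0 ≤ C) (hp : 0 < p) :
    ∫⁻ z in Ioi (1 : ℝ), ENNReal.ofReal ((C * z ^ (1 / (2 * p))) ^ p / z ^ 2) < ∞ := by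
  have h1 : IntegrableOn (fun z : ℝ => C ^ p * z ^ (-(3 / 2) : ℝ)) (Ioi 1) :=
    (integrableOn_Ioi_rpow_of_lt (by norm_num) one_pos).const_mul _
  refine lt_of_eq_of_lt (setLIntegral_congr_fun measurableSet_Ioi fun z hz => ?_)
    h1.lintegral_lt_top
  have hz0 : (0 : ℝ) < z := zero_lt_one.trans hz
  congr 1
  rw [Real.mul_rpow hC (by positivity), ← Real.rpow_mul hz0.le, mul_div_assoc,
    ← Real.rpow_natCast z 2, ← Real.rpow_sub hz0]
  congr 2
  field_simp
  norm_num

theorem tendsto_lintegral_rpow_div_sq {L : ℝ → ℝ → ℝ} {h : ℝ → ℝ} {C p : ℝ} (hC : 0 ≤ C)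
    (hp : 0 < p)
    (hmeas : ∀ᶠ t in atTop, AEMeasurable (L t) (volume.restrict (Ioi 1)))
    (hlim : ∀ z, 1 < z → Tendsto (fun t => L t z) atTop (𝓝 (h z)))
    (hbound : ∀ᶠ t in atTop, ∀ z, 1 < z → |L t z| ≤ C * z ^ (1 / (2 * p))) :
    Tendsto (fun t => (∫⁻ z in Ioi (1 : ℝ), ENNReal.ofReal (|L t z| ^ p / z ^ 2)) ^ (1 / p)) atTop
      (𝓝 ((∫⁻ z in Ioi (1 : ℝ), ENNReal.ofReal (|h z| ^ p / z ^ 2)) ^ (1 / p))) := by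
  refine (ENNReal.continuous_rpow_const.tendsto _).comp ?_
  refine tendsto_lintegral_filter_of_dominated_convergence'
    (fun z => ENNReal.ofReal ((C * z ^ (1 / (2 * p))) ^ p / z ^ 2)) ?_ ?_
    (lintegral_rpow_div_sq_lt_top hC hp).ne ?_
  · filter_upwards [hmeas] with t ht
    have : AEMeasurable (fun z => |L t z|) (volume.restrict (Ioi 1)) := by
      simpa [Real.norm_eq_abs] using ht.norm
    fun_prop
  · filter_upwards [hbound] with t ht
    filter_upwards [ae_restrict_mem measurableSet_Ioi] with z hz
    have := ht z hz
    gcongr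
  · filter_upwards [ae_restrict_mem measurableSet_Ioi] with z hz
    refine (ENNReal.continuous_ofReal.tendsto _).comp ?_
    exact (((hlim z hz).abs.rpow_const (Or.inr hp.le)).div_const _)

theorem aemeasurable_log_ratio {U : ℝ → ℝ} {t : ℝ} (γ : ℝ) (ht : 0 < t)
    (hU : MonotoneOn U (Ici t)) :
    AEMeasurable (fun z => Real.log (U (z * t) / (z ^ γ * U t))) (volume.restrict (Ioi 1)) := by
  have : AEMeasurable (fun z => U (z * t)) (volume.restrict (Ioi 1)) := by
    refine aemeasurable_restrict_of_monotoneOn measurableSet_Ioi fun x hx y hy hxy => ?_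
    exact hU (le_mul_of_one_le_left ht.le (le_of_lt hx)) (le_mul_of_one_le_left ht.le (le_of_lt hy))
      (mul_le_mul_of_nonneg_right hxy ht.le)
  exact Real.measurable_log.comp_aemeasurable (this.div (by fun_prop))

theorem log_ratio_eq {U : ℝ → ℝ} {t z : ℝ} (γ : ℝ) (hz : 0 < z) (hUt : 0 < U t)
    (hUz : 0 < U (z * t)) :
    Real.log (U (z * t) / (z ^ γ * U t))
      = Real.log (U (z * t)) - Real.log (U t) - γ * Real.log z := by
  rw [Real.log_div hUz.ne' (by positivity), Real.log_mul (by positivity) hUt.ne',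
    Real.log_rpow hz]
  ring

/-- A crude Potter bound, uniform on `[t₀, ∞)`. -/
theorem exists_log_ratio_bound {U : ℝ → ℝ} {t₀ γ : ℝ} (hγ : 0 < γ) (ht₀ : 0 < t₀)
    (hU : MonotoneOn U (Ici t₀)) (hpos : 0 < U t₀) {q : ℝ}
    (hlim : Tendsto (fun t => U (t * 2) / U t) atTop (𝓝 q)) {ε : ℝ} (hε : 0 < ε) :
    ∃ C, 0 ≤ C ∧ ∀ t, t₀ ≤ t → ∀ z, 1 < z →
      |Real.log (U (z * t) / (z ^ γ * U t))| ≤ C * z ^ ε := by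
  have hUpos : ∀ {t}, t₀ ≤ t → 0 < U t := fun ht => hpos.trans_le (hU self_mem_Ici ht ht)
  have hUlog : ∀ {s t}, t₀ ≤ s → s ≤ t → Real.log (U s) ≤ Real.log (U t) := fun hs hst =>
    Real.log_le_log (hUpos hs) (hU hs (hs.trans hst) hst)
  -- `M` is a doubling constant of `U` beyond `T`. Each doubling costs `K = log M`, and `z` is
  -- reached in at most `1 + log z / log 2` doublings.
  set M := max (q + 1) 1 with hM
  have hM1 : 1 ≤ M := le_max_right _ _
  set K := Real.log M with hKdef
  have hK : 0 ≤ K := Real.log_nonneg hM1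
  obtain ⟨T, hT⟩ := eventually_atTop.1 ((hlim.eventually (gt_mem_nhds (lt_add_one q))).and
    (eventually_ge_atTop t₀))
  have hTt : t₀ ≤ T := (hT T le_rfl).2
  have hdbl : ∀ t, T ≤ t → Real.log (U (t * 2)) ≤ K + Real.log (U t) := fun t ht => by
    have h1 := (hT t ht).1
    have hUt := hUpos (hTt.trans ht)
    rw [div_lt_iff₀ hUt] at h1
    have h2 : U (t * 2) ≤ M * U t :=
      h1.le.trans (mul_le_mul_of_nonneg_right (le_max_left _ _) hUt.le)
    rw [hKdef, ← Real.log_mul (by positivity) hUt.ne']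
    exact Real.log_le_log (hUpos (by linarith [hTt.trans ht])) h2
  have hlog2 : 0 < Real.log 2 := Real.log_pos (by norm_num)
  have key := forall_ge_of_mul_step (y := 2) (T := 1) (P := fun z => ∀ t, T ≤ t →
      Real.log (U (z * t)) - Real.log (U t) ≤ K * (1 + Real.log z / Real.log 2))
    (by norm_num) one_pos ?_ ?_
  -- For `t` in `[t₀, T]`, replacing `t` by `T` costs at most `K'`.
  · set K' := Real.log (U T) - Real.log (U t₀) with hK'
    have hK'0 : 0 ≤ K' := sub_nonneg.2 (hUlog le_rfl hTt)
    refine ⟨K + K' + (K / Real.log 2 + γ) / ε, by positivity, fun t ht z hz => ?_⟩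
    have hz0 : 0 < z := by linarith
    have ht0 : 0 < t := by linarith
    have htz : t ≤ z * t := le_mul_of_one_le_left ht0.le hz.le
    rw [log_ratio_eq γ hz0 (hUpos ht) (hUpos (ht.trans htz))]
    have hlz : 0 ≤ Real.log z := Real.log_nonneg hz.le
    have h1 : Real.log z ≤ z ^ ε / ε := Real.log_le_rpow_div hz0.le hε
    have h2 : 1 ≤ z ^ ε := Real.one_le_rpow hz.le hε.le
    have h3 := hUlog ht htz
    have h4 : Real.log (U (z * t)) - Real.log (U t) ≤ K * (1 + Real.log z / Real.log 2) + K' := by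
      rcases le_total T t with h | h
      · linarith [key z hz.le t h]
      · have h5 := key z hz.le T le_rfl
        have h6 := hUlog (ht.trans htz) (mul_le_mul_of_nonneg_left h hz0.le)
        have h7 := hUlog le_rfl ht
        linarith
    have h8 : K * (1 + Real.log z / Real.log 2) + K' + γ * Real.log z
        ≤ (K + K' + (K / Real.log 2 + γ) / ε) * z ^ ε := by
      calc K * (1 + Real.log z / Real.log 2) + K' + γ * Real.log z
          = (K + K') * 1 + (K / Real.log 2 + γ) * Real.log z := by ring
        _ ≤ (K + K') * z ^ ε + (K / Real.log 2 + γ) * (z ^ ε / ε) := by gcongr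
        _ = _ := by ring
    rw [abs_le]
    have h9 : 0 ≤ γ * Real.log z := by positivity
    have h10 : 0 ≤ K * (1 + Real.log z / Real.log 2) := by positivity
    constructor <;> linarith
  · intro z h1 h2 t ht
    have ht0 : 0 < t := by linarith
    have i1 := hUlog (hTt.trans (ht.trans (le_mul_of_one_le_left ht0.le h1)))
      (show z * t ≤ t * 2 by nlinarith)
    have i2 := hdbl t ht
    have : 0 ≤ K * (Real.log z / Real.log 2) := by
      have := Real.log_nonneg h1; positivity
    linarith
  · intro z h1 h2 t ht
    have ht0 : 0 < t := by linarith
    have i1 := h2 t ht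
    have i2 := hdbl (z * t) (ht.trans (le_mul_of_one_le_left ht0.le h1))
    rw [Real.log_mul (by linarith) (by norm_num), add_div, div_self hlog2.ne',
      show z * 2 * t = z * t * 2 by ring]
    linarith

end Domination

theorem Ap_bounded_and_tendsto_zero (μ : Measure ℝ) {γ t₀ : ℝ} (hγ : 0 < γ)
    (ht₀ : 1 < t₀) (hpos : 0 < tailQuantile μ t₀) {p : ℝ≥0∞} (hp : 1 ≤ p) (htop : p ≠ ∞)
    (h : InDomainOfAttraction μ γ) :
    (∃ M : ℝ, ∀ t : ℝ, t₀ ≤ t → Ap (tailQuantile μ) γ p t ≤ ENNReal.ofReal M) ∧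
      Tendsto (Ap (tailQuantile μ) γ p) atTop (𝓝 0) := by
  set U := tailQuantile μ with hUdef
  have hp0 : 0 < p.toReal := ENNReal.toReal_pos (zero_lt_one.trans_le hp).ne' htop
  have hU : MonotoneOn U (Ici t₀) :=
    (monotoneOn_tailQuantile μ).mono fun s hs => ht₀.trans_le hs
  have hUpos : ∀ {t}, t₀ ≤ t → 0 < U t := fun ht => hpos.trans_le (hU self_mem_Ici ht ht)
  obtain ⟨C, hC, hbd⟩ := exists_log_ratio_bound hγ (by linarith) hU hpos
    (tendsto_tailQuantile_ratio hγ h one_lt_two) (ε := 1 / (2 * p.toReal)) (by positivity)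
  have hAp : ∀ t, Ap U γ p t = (∫⁻ z in Ioi (1 : ℝ), ENNReal.ofReal
      (|Real.log (U (z * t) / (z ^ γ * U t))| ^ p.toReal / z ^ 2)) ^ (1 / p.toReal) := fun t => by
    rw [Ap, if_neg htop]
  refine ⟨⟨((∫⁻ z in Ioi (1 : ℝ), ENNReal.ofReal
      ((C * z ^ (1 / (2 * p.toReal))) ^ p.toReal / z ^ 2)) ^ (1 / p.toReal)).toReal,
      fun t ht => ?_⟩, ?_⟩
  · rw [ENNReal.ofReal_toReal (ENNReal.rpow_ne_top_of_nonneg (by positivity)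
      (lintegral_rpow_div_sq_lt_top hC hp0).ne), hAp]
    refine ENNReal.rpow_le_rpow (setLIntegral_mono' measurableSet_Ioi fun z hz => ?_)
      (by positivity)
    have := hbd t ht z hz
    gcongr
  · have hlim := tendsto_lintegral_rpow_div_sq (h := fun _ => 0)
      (L := fun t z => Real.log (U (z * t) / (z ^ γ * U t))) hC hp0 ?_ ?_ ?_
    · have hz : (∫⁻ z in Ioi (1 : ℝ), ENNReal.ofReal (|(0 : ℝ)| ^ p.toReal / z ^ 2))
          ^ (1 / p.toReal) = 0 := by
        simp [Real.zero_rpow hp0.ne', hp0]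
      rw [hz] at hlim
      exact hlim.congr fun t => (hAp t).symm
    · filter_upwards [eventually_ge_atTop t₀] with t ht
      exact aemeasurable_log_ratio γ (by linarith) (hU.mono (Ici_subset_Ici.2 ht))
    · intro z hz
      have hz0 : 0 < z := by linarith
      have h1 := (tendsto_tailQuantile_ratio hγ h hz).div_const (z ^ γ)
      rw [div_self (by positivity)] at h1
      have h2 := (Real.continuousAt_log one_ne_zero).tendsto.comp h1
      rw [Real.log_one] at h2
      refine h2.congr fun t => ?_
      simp only [Function.comp_apply]
      rw [div_div, mul_comm z t, mul_comm (z ^ γ)]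
    · filter_upwards [eventually_ge_atTop t₀] with t ht
      exact hbd t ht

/-! ### Uniform convergence and Potter bounds in additive form -/

section UniformConvergence

/-- The complements of `P n` and `Q n` in `[0,2]` eventually have measure below `1/2`, so a
translate of one together with the other cannot cover `[0,1]`. -/
theorem eventually_exists_shift_mem {P Q : ℕ → Set ℝ} (hPm : ∀ n, MeasurableSet (P n))
    (hQm : ∀ n, MeasurableSet (Q n)) (hP : ∀ x ∈ Icc (0 : ℝ) 2, ∀ᶠ n in atTop, x ∈ P n)
    (hQ : ∀ x ∈ Icc (0 : ℝ) 2, ∀ᶠ n in atTop, x ∈ Q n) {s : ℕ → ℝ}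
    (hs : ∀ n, s n ∈ Icc (0 : ℝ) 1) :
    ∀ᶠ n in atTop, ∃ x ∈ Icc (0 : ℝ) 1, x ∈ Q n ∧ s n + x ∈ P n := by
  have key : ∀ {R : ℕ → Set ℝ}, (∀ n, MeasurableSet (R n)) →
      (∀ x ∈ Icc (0 : ℝ) 2, ∀ᶠ n in atTop, x ∈ R n) →
      ∀ᶠ n in atTop, volume (Icc 0 2 \ R n) < 1 / 2 := by
    intro R hRm hR
    have := tendsto_measure_of_ae_tendsto_indicator (L := atTop) (μ := (volume : Measure ℝ))
      (As := fun n => Icc 0 2 \ R n) (A := ∅) (B := Icc 0 2) MeasurableSet.empty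
      (fun n => measurableSet_Icc.diff (hRm n)) measurableSet_Icc (by simp)
      (Eventually.of_forall fun n => sdiff_subset) (ae_of_all _ fun x => ?_)
    · rw [measure_empty] at this
      exact this.eventually (gt_mem_nhds (by norm_num))
    · by_cases hx : x ∈ Icc (0 : ℝ) 2
      · filter_upwards [hR x hx] with n hn
        simp [hn]
      · exact Eventually.of_forall fun n => by simp [hx]
  filter_upwards [key hPm hP, key hQm hQ] with n h1 h2
  by_contra! hno
  have hsub : Icc (0 : ℝ) 1 ⊆ (Icc 0 2 \ Q n) ∪ (fun x => s n + x) ⁻¹' (Icc 0 2 \ P n) := by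
    intro x hx
    by_cases hq : x ∈ Q n
    · right
      exact ⟨⟨add_nonneg (hs n).1 hx.1, by linarith [(hs n).2, hx.2]⟩, hno x hx hq⟩
    · left
      exact ⟨⟨hx.1, by linarith [hx.2]⟩, hq⟩
  have hle := (measure_mono (μ := volume) hsub).trans (measure_union_le _ _)
  rw [measure_preimage_add, Real.volume_Icc, sub_zero, ENNReal.ofReal_one] at hle
  have := hle.trans_lt (ENNReal.add_lt_add h2 h1)
  rw [ENNReal.add_halves] at this
  exact lt_irrefl _ this

/-- Pointwise convergence of increments of a measurable function is locally uniform. -/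
theorem eventually_forall_increment_close {v b h k : ℝ → ℝ} (hv : Measurable v)
    (hh : Continuous h) (hk : ∀ s ∈ Icc (0 : ℝ) 1, |k s| ≤ 1)
    (hadd : ∀ s x, h (s + x) = h s + k s * h x) (hb : ∀ᶠ u in atTop, b u ≠ 0)
    (hlim : ∀ s, 0 ≤ s → Tendsto (fun u => (v (u + s) - v u) / b u) atTop (𝓝 (h s)))
    (hbk : ∀ ε > 0, ∀ᶠ u in atTop, ∀ s ∈ Icc (0 : ℝ) 1, |b (u + s) / b u - k s| ≤ ε)
    {ε : ℝ} (hε : 0 < ε) :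
    ∀ᶠ u in atTop, ∀ s ∈ Icc (0 : ℝ) 1, |(v (u + s) - v u) / b u - h s| ≤ ε := by
  by_contra hcon
  obtain ⟨u, hu, hu'⟩ := exists_seq_forall_of_frequently (not_eventually.1 hcon)
  push Not at hu'
  choose s hs hsε using hu'
  obtain ⟨H, hH⟩ := isCompact_Icc.exists_bound_of_continuousOn (s := Icc (0 : ℝ) 1)
    hh.continuousOn
  have hH0 : 0 ≤ H := (norm_nonneg _).trans (hH 0 (by simp))
  -- The three error terms below add up to at most `η + η + η (H + η) ≤ η (3 + H)`.
  set η := min 1 (ε / (3 + H)) with hη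
  have hη0 : 0 < η := lt_min one_pos (by positivity)
  have hη1 : η ≤ 1 := min_le_left _ _
  have hηε : η * (3 + H) ≤ ε := by
    rw [← le_div_iff₀ (by positivity)]; exact min_le_right _ _
  have hus : Tendsto (fun n => u n + s n) atTop atTop :=
    tendsto_atTop_mono (fun n => le_add_of_nonneg_right (hs n).1) hu
  have hev : ∀ {w : ℕ → ℝ}, Tendsto w atTop atTop → ∀ x ∈ Icc (0 : ℝ) 2, ∀ᶠ n in atTop,
      x ∈ {x | |(v (w n + x) - v (w n)) / b (w n) - h x| ≤ η} := by
    intro w hw x hx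
    have := (hlim x hx.1).comp hw
    filter_upwards [this.eventually (Metric.closedBall_mem_nhds _ hη0)] with n hn
    exact hn
  have hm : ∀ (w : ℕ → ℝ) n,
      MeasurableSet {x | |(v (w n + x) - v (w n)) / b (w n) - h x| ≤ η} := fun w n => by
    have := hh.measurable
    exact measurableSet_le (by fun_prop) measurable_const
  -- This provides `x` for which the increments over `s n + x` from `u n` and over `x` from `u n + s
  -- n` are both close to their limits. Subtracting them controls the increment over `s n` by
  -- `hadd`.
  have hex := eventually_exists_shift_mem (hm u) (hm fun n => u n + s n) (hev hu) (hev hus) hs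
  obtain ⟨n, ⟨x, hx, hxQ, hxP⟩, hn1, hn2, hn3⟩ := (hex.and ((hu.eventually hb).and
    ((hus.eventually hb).and (hu.eventually (hbk η hη0))))).exists
  simp only [mem_ofPred_eq] at hxQ hxP
  have hr := hn3 _ (hs n)
  have hks := hk _ (hs n)
  refine absurd (hsε n) (not_lt.2 ?_)
  rw [hadd, ← add_assoc] at hxP
  set a := (v (u n + s n + x) - v (u n)) / b (u n)
  set c := (v (u n + s n + x) - v (u n + s n)) / b (u n + s n) with hc
  set r := b (u n + s n) / b (u n) with hrdef
  have e1 : (v (u n + s n) - v (u n)) / b (u n) = a - r * c := by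
    simp only [a, hc, hrdef]; field_simp; ring
  have hcH : |c| ≤ H + η := by
    have h1 := hH x hx
    rw [Real.norm_eq_abs] at h1
    have := abs_add_le (c - h x) (h x)
    rw [sub_add_cancel] at this
    linarith
  rw [e1, show a - r * c - h (s n)
    = (a - (h (s n) + k (s n) * h x)) - k (s n) * (c - h x) - (r - k (s n)) * c by ring]
  have t1 : |k (s n) * (c - h x)| ≤ 1 * η := by
    rw [abs_mul]; gcongr
  have t2 : |(r - k (s n)) * c| ≤ η * (H + η) := by
    rw [abs_mul]; gcongr
  have t3 := abs_sub (a - (h (s n) + k (s n) * h x) - k (s n) * (c - h x)) ((r - k (s n)) * c)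
  have t4 := abs_sub (a - (h (s n) + k (s n) * h x)) (k (s n) * (c - h x))
  nlinarith

theorem continuous_boxCox_exp (ρ : ℝ) : Continuous fun s => boxCox ρ (Real.exp s) := by
  unfold boxCox
  split_ifs with h
  · simpa using continuous_id'
  · exact ((Real.continuous_exp.rpow_const fun s => Or.inl (Real.exp_pos s).ne').sub
      continuous_const).div_const _

theorem boxCox_mul (ρ : ℝ) {x y : ℝ} (hx : 0 < x) (hy : 0 < y) :
    boxCox ρ (x * y) = boxCox ρ x + x ^ ρ * boxCox ρ y := by
  unfold boxCox
  split_ifs with h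
  · rw [h, Real.log_mul hx.ne' hy.ne', Real.rpow_zero, one_mul]
  · rw [Real.mul_rpow hx.le hy.le]; field_simp; ring

theorem boxCox_one (ρ : ℝ) : boxCox ρ 1 = 0 := by
  simp [boxCox]

theorem monotoneOn_boxCox {ρ : ℝ} (hρ : ρ ≤ 0) : MonotoneOn (boxCox ρ) (Ioi 0) := by
  intro x hx y hy hxy
  unfold boxCox
  split_ifs with h
  · exact Real.log_le_log hx hxy
  · have hρ' : ρ < 0 := lt_of_le_of_ne hρ h
    exact div_le_div_of_nonpos_of_le hρ
      (sub_le_sub_right (Real.rpow_le_rpow_of_nonpos hx hxy hρ) 1)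

theorem boxCox_pos (ρ : ℝ) {x : ℝ} (hx : 1 < x) : 0 < boxCox ρ x := by
  have hx0 : 0 < x := by linarith
  unfold boxCox
  split_ifs with h
  · exact Real.log_pos hx
  · rcases lt_or_gt_of_ne h with h | h
    · exact div_pos_of_neg_of_neg (sub_neg.2 (Real.rpow_lt_one_of_one_lt_of_neg hx h)) h
    · exact div_pos (sub_pos.2 (Real.one_lt_rpow hx h)) h

variable {v b : ℝ → ℝ} {ρ : ℝ}

/-- Uniform convergence theorem for the auxiliary function in the second-order condition. -/
theorem eventually_forall_ratio_close (hρ : ρ ≤ 0) (hv : Measurable v)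
    (hsign : ∀ᶠ u in atTop, ∀ u', u ≤ u' → 0 < b u' / b u)
    (hbk : ∀ s, 0 ≤ s → Tendsto (fun u => b (u + s) / b u) atTop (𝓝 (Real.exp s ^ ρ)))
    (hlim : ∀ s, 0 ≤ s → Tendsto (fun u => (v (u + s) - v u) / b u) atTop
      (𝓝 (boxCox ρ (Real.exp s)))) {ε : ℝ} (hε : 0 < ε) :
    ∀ᶠ u in atTop, ∀ s ∈ Icc (0 : ℝ) 1, |b (u + s) / b u - Real.exp s ^ ρ| ≤ ε := by
  have hb : ∀ᶠ u in atTop, b u ≠ 0 := hsign.mono fun u hu h0 => by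
    have := hu u le_rfl
    rw [h0, div_zero] at this
    exact lt_irrefl _ this
  set κ := boxCox ρ (Real.exp 1) with hκ
  have hκ0 : 0 < κ := boxCox_pos ρ (Real.one_lt_exp_iff.2 one_pos)
  -- No measurability of `b` is assumed. The unit increment `c` of `v` is measurable and `c / b → κ
  -- > 0`, so uniform convergence for `log c` passes to `log b`. As `Real.log` is the logarithm of
  -- the absolute value, negative `b` is covered.
  set c : ℝ → ℝ := fun u => v (u + 1) - v u with hcdef
  have hcb : Tendsto (fun u => c u / b u) atTop (𝓝 κ) := hlim 1 zero_le_one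
  have hc : ∀ᶠ u in atTop, c u ≠ 0 := by
    filter_upwards [hcb.eventually (lt_mem_nhds hκ0)] with u hu h0
    rw [h0, zero_div] at hu
    exact lt_irrefl _ hu
  have hcm : Measurable fun u => Real.log (c u) := by fun_prop
  have hshift : ∀ s : ℝ, Tendsto (fun u : ℝ => u + s) atTop atTop := fun s =>
    tendsto_atTop_add_const_right _ _ tendsto_id
  have hlogcb : Tendsto (fun u => Real.log (c u) - Real.log (b u)) atTop (𝓝 (Real.log κ)) := by
    refine ((Real.continuousAt_log hκ0.ne').tendsto.comp hcb).congr' ?_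
    filter_upwards [hb, hc] with u h1 h2
    exact Real.log_div h2 h1
  have hlogb : ∀ s, 0 ≤ s →
      Tendsto (fun u => Real.log (b (u + s)) - Real.log (b u)) atTop (𝓝 (ρ * s)) := by
    intro s hs
    have := (Real.continuousAt_log (Real.rpow_pos_of_pos (Real.exp_pos s) ρ).ne').tendsto.comp
      (hbk s hs)
    rw [Real.log_rpow (Real.exp_pos s), Real.log_exp] at this
    refine this.congr' ?_
    filter_upwards [hb, (hshift s).eventually hb] with u h1 h2
    exact Real.log_div h2 h1
  have hw : ∀ δ > 0, ∀ᶠ u in atTop, ∀ s ∈ Icc (0 : ℝ) 1,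
      |(Real.log (c (u + s)) - Real.log (c u)) / 1 - ρ * s| ≤ δ := by
    intro δ hδ
    refine eventually_forall_increment_close (b := fun _ => 1) (h := fun s => ρ * s)
      (k := fun _ => 1) hcm (by fun_prop) (by simp) (fun s x => by ring) (by simp) ?_ ?_ hδ
    · intro s hs
      have := ((hlogcb.comp (hshift s)).sub hlogcb).add (hlogb s hs)
      rw [sub_self, zero_add] at this
      refine this.congr fun u => ?_
      simp only [Function.comp_apply]
      ring
    · intro δ hδ
      exact Eventually.of_forall fun u s _ => by simp [hδ.le]
  have hexp : ∀ᶠ y in 𝓝 (0 : ℝ), |Real.exp y - 1| < ε := by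
    have := Real.continuous_exp.tendsto 0
    rw [Real.exp_zero] at this
    exact this.eventually (Metric.ball_mem_nhds _ hε)
  obtain ⟨δ, hδ, hδε⟩ := Metric.eventually_nhds_iff.1 hexp
  obtain ⟨T, hT⟩ := eventually_atTop.1 (hlogcb.eventually
    (Metric.ball_mem_nhds _ (show 0 < δ / 4 by positivity)))
  filter_upwards [hw (δ / 4) (by positivity), hsign, eventually_ge_atTop T] with u h1 h2 h3 s hs
  have a1 := h1 s hs
  have a2 := hT u h3
  have a3 := hT (u + s) (h3.trans (le_add_of_nonneg_right hs.1))
  have hpos := h2 (u + s) (le_add_of_nonneg_right hs.1)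
  rw [Real.dist_eq] at a2 a3
  rw [div_one] at a1
  have hne : b u ≠ 0 := fun h0 => by rw [h0, div_zero] at hpos; exact lt_irrefl _ hpos
  have hne' : b (u + s) ≠ 0 := fun h0 => by rw [h0, zero_div] at hpos; exact lt_irrefl _ hpos
  have hy : |Real.log (b (u + s) / b u) - ρ * s| < δ := by
    rw [Real.log_div hne' hne]
    rw [abs_le] at a1
    rw [abs_lt] at a2 a3 ⊢
    constructor <;> linarith [a1.1, a1.2, a2.1, a2.2, a3.1, a3.2]
  have hy' := hδε (y := Real.log (b (u + s) / b u) - ρ * s) (by rwa [Real.dist_eq, sub_zero])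
  have hk : Real.exp s ^ ρ = Real.exp (ρ * s) := by rw [← Real.exp_mul, mul_comm]
  have hk1 : Real.exp (ρ * s) ≤ 1 :=
    Real.exp_le_one_iff.2 (mul_nonpos_of_nonpos_of_nonneg hρ hs.1)
  have e1 : b (u + s) / b u - Real.exp s ^ ρ
      = Real.exp (ρ * s) * (Real.exp (Real.log (b (u + s) / b u) - ρ * s) - 1) := by
    rw [mul_sub, ← Real.exp_add, add_sub_cancel, Real.exp_log hpos, hk, mul_one]
  rw [e1, abs_mul, abs_of_pos (Real.exp_pos _)]
  calc _ ≤ 1 * ε := by gcongr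
    _ = ε := one_mul _

/-- Telescoping over unit steps: the `j`-th step costs at most `C q^j |b u|`. -/
theorem abs_increment_le_geom_sum {T C q : ℝ} (hC : 0 ≤ C)
    (h1 : ∀ u, T ≤ u → ∀ s ∈ Icc (0 : ℝ) 1, |v (u + s) - v u| ≤ C * |b u|)
    (h2 : ∀ u, T ≤ u → |b (u + 1)| ≤ q * |b u|) (n : ℕ) :
    ∀ u, T ≤ u → ∀ s ∈ Icc (0 : ℝ) 1,
      |v (u + n + s) - v u| ≤ C * |b u| * ∑ j ∈ Finset.range (n + 1), q ^ j := by
  induction n with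
  | zero => intro u hu s hs; simpa using h1 u hu s hs
  | succ n ih =>
    intro u hu s hs
    have i1 := ih (u + 1) (by linarith) s hs
    have i2 := h1 u hu 1 (by simp)
    have i3 := h2 u hu
    have hS : |b (u + 1)| * ∑ j ∈ Finset.range (n + 1), q ^ j
        ≤ q * |b u| * ∑ j ∈ Finset.range (n + 1), q ^ j := by
      rcases (abs_nonneg (b u)).eq_or_lt with h0 | h0
      · rw [← h0, mul_zero] at i3
        rw [le_antisymm i3 (abs_nonneg _), ← h0]; simp
      · have hq : 0 ≤ q := by
          by_contra hq
          have := mul_neg_of_neg_of_pos (not_le.1 hq) h0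
          linarith [abs_nonneg (b (u + 1))]
        exact mul_le_mul_of_nonneg_right i3 (Finset.sum_nonneg fun j _ => pow_nonneg hq j)
    have i4 := mul_le_mul_of_nonneg_left hS hC
    have i5 := abs_add_le (v (u + 1 + n + s) - v (u + 1)) (v (u + 1) - v u)
    rw [show v (u + 1 + n + s) - v (u + 1) + (v (u + 1) - v u)
      = v (u + ((n + 1 : ℕ) : ℝ) + s) - v u by push_cast; ring_nf] at i5
    rw [geom_sum_succ]
    linarith

/-- A Potter-type bound for the increments in the second-order condition. -/
theorem eventually_forall_abs_increment_le (hρ : ρ ≤ 0) (hv : Measurable v)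
    (hsign : ∀ᶠ u in atTop, ∀ u', u ≤ u' → 0 < b u' / b u)
    (hbk : ∀ s, 0 ≤ s → Tendsto (fun u => b (u + s) / b u) atTop (𝓝 (Real.exp s ^ ρ)))
    (hlim : ∀ s, 0 ≤ s → Tendsto (fun u => (v (u + s) - v u) / b u) atTop
      (𝓝 (boxCox ρ (Real.exp s)))) {C q : ℝ} (hC : boxCox ρ (Real.exp 1) < C)
    (hq : Real.exp 1 ^ ρ < q) :
    ∀ᶠ u in atTop, ∀ n : ℕ, ∀ s ∈ Icc (0 : ℝ) 1,
      |(v (u + n + s) - v u) / b u| ≤ C * ∑ j ∈ Finset.range (n + 1), q ^ j := by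
  have hb : ∀ᶠ u in atTop, b u ≠ 0 := hsign.mono fun u hu h0 => by
    have := hu u le_rfl
    rw [h0, div_zero] at this
    exact lt_irrefl _ this
  have hC0 : 0 < C := (boxCox_pos ρ (Real.one_lt_exp_iff.2 one_pos)).trans hC
  have hunif := eventually_forall_increment_close (k := fun s => Real.exp s ^ ρ) hv
    (continuous_boxCox_exp ρ) (fun s hs => by
      rw [abs_of_pos (by positivity)]
      exact Real.rpow_le_one_of_one_le_of_nonpos (Real.one_le_exp hs.1) hρ)
    (fun s x => by rw [Real.exp_add, boxCox_mul ρ (Real.exp_pos _) (Real.exp_pos _)]) hb hlim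
    (fun ε hε => eventually_forall_ratio_close hρ hv hsign hbk hlim hε) (sub_pos.2 hC)
  obtain ⟨T, hT⟩ := eventually_atTop.1 ((hunif.and
    ((hbk 1 zero_le_one).eventually (gt_mem_nhds hq))).and (hb.and hsign))
  have h1 : ∀ u, T ≤ u → ∀ s ∈ Icc (0 : ℝ) 1, |v (u + s) - v u| ≤ C * |b u| := by
    intro u hu s hs
    have hbu := (hT u hu).2.1
    have i1 := (hT u hu).1.1 s hs
    have i2 : 0 ≤ boxCox ρ (Real.exp s) := by
      rw [← boxCox_one ρ]
      exact monotoneOn_boxCox hρ (by simp) (mem_Ioi.2 (Real.exp_pos _)) (Real.one_le_exp hs.1)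
    have i3 : boxCox ρ (Real.exp s) ≤ boxCox ρ (Real.exp 1) :=
      monotoneOn_boxCox hρ (mem_Ioi.2 (Real.exp_pos _)) (mem_Ioi.2 (Real.exp_pos _))
        (Real.exp_le_exp.2 hs.2)
    rw [← div_le_iff₀ (abs_pos.2 hbu), ← abs_div]
    rw [abs_le] at i1 ⊢
    constructor <;> linarith [i1.1, i1.2]
  have h2 : ∀ u, T ≤ u → |b (u + 1)| ≤ q * |b u| := by
    intro u hu
    have hbu := (hT u hu).2.1
    rw [← div_le_iff₀ (abs_pos.2 hbu), ← abs_div,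
      abs_of_pos ((hT u hu).2.2 (u + 1) (by linarith))]
    exact (hT u hu).1.2.le
  filter_upwards [eventually_ge_atTop T] with u hu n s hs
  have := abs_increment_le_geom_sum hC0.le h1 h2 n u hu s hs
  rw [abs_div, div_le_iff₀ (abs_pos.2 (hT u hu).2.1)]
  linarith

end UniformConvergence

/-! ### The second-order limit -/

section SecondOrder

variable {U A : ℝ → ℝ} {γ ρ : ℝ}

/-- The hypotheses force `R → 1`, where `log R` is equivalent to `R - 1`; `dslope` expresses the
quotient without excluding `R = 1`. -/
theorem tendsto_log_div {R A : ℝ → ℝ} {c : ℝ} (hA : Tendsto A atTop (𝓝 0))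
    (hA0 : ∀ᶠ t in atTop, A t ≠ 0) (h : Tendsto (fun t => (R t - 1) / A t) atTop (𝓝 c)) :
    Tendsto (fun t => Real.log (R t) / A t) atTop (𝓝 c) := by
  have hR : Tendsto R atTop (𝓝 1) := by
    have := (h.mul hA).add_const 1
    rw [mul_zero, zero_add] at this
    refine this.congr' ?_
    filter_upwards [hA0] with t ht
    rw [div_mul_cancel₀ _ ht, sub_add_cancel]
  have hd : ContinuousAt (dslope Real.log 1) 1 :=
    continuousAt_dslope_same.2 (Real.differentiableAt_log one_ne_zero)
  have hd1 : dslope Real.log 1 1 = 1 := by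
    rw [dslope_same, Real.deriv_log, inv_one]
  have h2 := h.mul (hd.tendsto.comp hR)
  rw [hd1, mul_one] at h2
  refine h2.congr fun t => ?_
  have := sub_smul_dslope Real.log 1 (R t)
  rw [Real.log_one, sub_zero, smul_eq_mul] at this
  rw [← this, Function.comp_apply]
  ring

theorem SecondOrderCondition.eventually_ne_zero (h : SecondOrderCondition U γ ρ A) :
    ∀ᶠ t in atTop, A t ≠ 0 :=
  h.eventually_sign.elim (fun h => h.mono fun _ ht => ht.ne') fun h => h.mono fun _ ht => ht.ne

theorem SecondOrderCondition.tendsto_log_ratio (h : SecondOrderCondition U γ ρ A)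
    (hU : ∀ᶠ t in atTop, 0 < U t) {z : ℝ} (hz : 0 < z) :
    Tendsto (fun t => Real.log (U (z * t) / (z ^ γ * U t)) / A t) atTop (𝓝 (boxCox ρ z)) := by
  refine tendsto_log_div h.tendsto_zero h.eventually_ne_zero ?_
  have hzγ : 0 < z ^ γ := by positivity
  have := (h.limit z hz).div_const (z ^ γ)
  rw [mul_div_cancel_left₀ _ hzγ.ne'] at this
  refine this.congr' ?_
  filter_upwards [hU] with t ht
  rw [div_right_comm, mul_comm t z]
  congr 1
  field_simp

theorem SecondOrderCondition.eventually_forall_abs_log_ratio_le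
    (h : SecondOrderCondition U γ ρ A) {t₀ : ℝ} (ht₀ : 0 < t₀) (hU : MonotoneOn U (Ici t₀))
    (hpos : 0 < U t₀) {C q : ℝ} (hC : boxCox ρ (Real.exp 1) < C) (hq : Real.exp 1 ^ ρ < q) :
    ∀ᶠ t in atTop, ∀ z, 1 < z → |Real.log (U (z * t) / (z ^ γ * U t)) / A t|
      ≤ C * ∑ j ∈ Finset.range (⌊Real.log z⌋₊ + 1), q ^ j := by
  have hUpos : ∀ {t}, t₀ ≤ t → 0 < U t := fun ht => hpos.trans_le (hU self_mem_Ici ht ht)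
  set v : ℝ → ℝ := fun u => Real.log (U (max (Real.exp u) t₀)) - γ * u with hvdef
  set b : ℝ → ℝ := fun u => A (Real.exp u) with hbdef
  have hmono : Monotone fun u => U (max (Real.exp u) t₀) := fun x y hxy =>
    hU (show t₀ ≤ _ from le_max_right _ _) (show t₀ ≤ _ from le_max_right _ _)
      (max_le_max_right _ (Real.exp_le_exp.2 hxy))
  have hv : Measurable v :=
    (Real.measurable_log.comp hmono.measurable).sub (by fun_prop)
  have hvlog : ∀ t, t₀ ≤ t → ∀ z, 1 ≤ z →
      Real.log (U (z * t) / (z ^ γ * U t)) = v (Real.log t + Real.log z) - v (Real.log t) := by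
    intro t ht z hz
    have ht0 : 0 < t := by linarith
    have hz0 : 0 < z := by linarith
    have hzt : t₀ ≤ z * t := ht.trans (le_mul_of_one_le_left ht0.le hz)
    rw [log_ratio_eq γ hz0 (hUpos ht) (hUpos hzt)]
    simp only [hvdef, Real.exp_add, Real.exp_log ht0, Real.exp_log hz0]
    rw [mul_comm t z, max_eq_left ht, max_eq_left hzt]
    ring
  have hsign : ∀ᶠ u in atTop, ∀ u', u ≤ u' → 0 < b u' / b u := by
    rcases h.eventually_sign with hs | hs
    · obtain ⟨T, hT⟩ := eventually_atTop.1 (Real.tendsto_exp_atTop.eventually hs)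
      filter_upwards [eventually_ge_atTop T] with u hu u' hu'
      exact div_pos (hT _ (hu.trans hu')) (hT _ hu)
    · obtain ⟨T, hT⟩ := eventually_atTop.1 (Real.tendsto_exp_atTop.eventually hs)
      filter_upwards [eventually_ge_atTop T] with u hu u' hu'
      exact div_pos_of_neg_of_neg (hT _ (hu.trans hu')) (hT _ hu)
  have hbk : ∀ s, 0 ≤ s → Tendsto (fun u => b (u + s) / b u) atTop (𝓝 (Real.exp s ^ ρ)) := by
    intro s _
    refine ((h.regularlyVarying _ (Real.exp_pos s)).comp Real.tendsto_exp_atTop).congr fun u => ?_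
    simp only [Function.comp_apply, hbdef, Real.exp_add]
  have hUev : ∀ᶠ t in atTop, 0 < U t := by
    filter_upwards [eventually_ge_atTop t₀] with t ht using hUpos ht
  have hlim : ∀ s, 0 ≤ s → Tendsto (fun u => (v (u + s) - v u) / b u) atTop
      (𝓝 (boxCox ρ (Real.exp s))) := by
    intro s hs
    refine ((h.tendsto_log_ratio hUev (Real.exp_pos s)).comp Real.tendsto_exp_atTop).congr' ?_
    filter_upwards [Real.tendsto_exp_atTop.eventually (eventually_ge_atTop t₀)] with u hu
    rw [Function.comp_apply, hvlog _ hu _ (Real.one_le_exp hs), Real.log_exp, Real.log_exp]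
  have hmain := eventually_forall_abs_increment_le h.rho_nonpos hv hsign hbk hlim hC hq
  filter_upwards [Real.tendsto_log_atTop.eventually hmain, eventually_ge_atTop t₀]
    with t ht1 ht2 z hz
  have hlz : 0 ≤ Real.log z := Real.log_nonneg hz.le
  -- Multiplication by `z` is a shift by `log z`: whole unit steps plus a remainder in `[0,1]`.
  have i1 := ht1 ⌊Real.log z⌋₊ (Real.log z - ⌊Real.log z⌋₊)
    ⟨sub_nonneg.2 (Nat.floor_le hlz), by linarith [Nat.lt_floor_add_one (Real.log z)]⟩
  rw [add_assoc, add_sub_cancel] at i1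
  rw [hvlog t ht2 z hz.le]
  simpa only [hbdef, Real.exp_log (ht₀.trans_le ht2)] using i1

theorem Ap_div_ofReal_abs {p : ℝ≥0∞} (hp : 1 ≤ p) (htop : p ≠ ∞) {t : ℝ} (hA : A t ≠ 0) :
    Ap U γ p t / ENNReal.ofReal |A t| = (∫⁻ z in Ioi (1 : ℝ), ENNReal.ofReal
      (|Real.log (U (z * t) / (z ^ γ * U t)) / A t| ^ p.toReal / z ^ 2)) ^ (1 / p.toReal) := by
  have hp0 : 0 < p.toReal := ENNReal.toReal_pos (zero_lt_one.trans_le hp).ne' htop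
  have hA0 : 0 < |A t| := abs_pos.2 hA
  have e1 : ∀ z : ℝ, ENNReal.ofReal
      (|Real.log (U (z * t) / (z ^ γ * U t)) / A t| ^ p.toReal / z ^ 2)
      = ENNReal.ofReal (|A t|⁻¹ ^ p.toReal) * ENNReal.ofReal
        (|Real.log (U (z * t) / (z ^ γ * U t))| ^ p.toReal / z ^ 2) := by
    intro z
    rw [← ENNReal.ofReal_mul (by positivity), abs_div, div_eq_mul_inv |Real.log _|,
      Real.mul_rpow (abs_nonneg _) (by positivity)]
    congr 1
    ring
  simp_rw [e1]
  rw [lintegral_const_mul' _ _ ENNReal.ofReal_ne_top, Ap, if_neg htop,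
    ENNReal.mul_rpow_of_nonneg _ _ (by positivity),
    ENNReal.ofReal_rpow_of_nonneg (by positivity) (by positivity),
    ← Real.rpow_mul (by positivity), mul_one_div_cancel hp0.ne', Real.rpow_one,
    ENNReal.ofReal_inv_of_pos hA0, mul_comm, div_eq_mul_inv]

theorem Ap_top_div_ofReal_abs {t : ℝ} (hA : A t ≠ 0) :
    Ap U γ ∞ t / ENNReal.ofReal |A t| = ⨆ z ∈ Ioi (1 : ℝ),
      ENNReal.ofReal |Real.log (U (z * t) / (z ^ γ * U t)) / A t| := by
  have hA0 : 0 < |A t| := abs_pos.2 hA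
  simp_rw [abs_div, ENNReal.ofReal_div_of_pos hA0]
  rw [Ap, if_pos rfl]
  simp_rw [ENNReal.iSup_div]

/-- In both cases `cConst ∞ ρ` is the limit of `boxCox ρ` at infinity. -/
theorem exists_boxCox_gt {c : ℝ≥0∞} (hρ : ρ ≤ 0) (hc : c < cConst ∞ ρ) :
    ∃ z : ℝ, 1 < z ∧ c < ENNReal.ofReal (boxCox ρ z) := by
  rw [cConst, if_pos rfl] at hc
  have hlim : Tendsto (fun z => ENNReal.ofReal (boxCox ρ z)) atTop
      (𝓝 (if ρ = 0 then ∞ else ENNReal.ofReal (1 / |ρ|))) := by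
    split_ifs with h
    · simpa only [boxCox, if_pos h] using ENNReal.tendsto_ofReal_nhds_top.2 Real.tendsto_log_atTop
    · simp only [boxCox, if_neg h]
      refine (ENNReal.continuous_ofReal.tendsto _).comp ?_
      have hρ' : 0 < -ρ := neg_pos.2 (lt_of_le_of_ne hρ h)
      have := ((tendsto_rpow_neg_atTop hρ').sub_const 1).div_const ρ
      rw [neg_neg] at this
      convert this using 2
      rw [abs_of_nonpos hρ]
      field_simp
      ring
  exact ((eventually_gt_atTop 1).and (hlim.eventually (lt_mem_nhds hc))).exists

theorem tendsto_Ap_top_div {t₀ : ℝ} (h : SecondOrderCondition U γ ρ A) (ht₀ : 0 < t₀)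
    (hU : MonotoneOn U (Ici t₀)) (hpos : 0 < U t₀) :
    Tendsto (fun t => Ap U γ ∞ t / ENNReal.ofReal |A t|) atTop (𝓝 (cConst ∞ ρ)) := by
  have hUev : ∀ᶠ t in atTop, 0 < U t := by
    filter_upwards [eventually_ge_atTop t₀] with t ht
    exact hpos.trans_le (hU self_mem_Ici ht ht)
  have hρ := h.rho_nonpos
  refine tendsto_order.2 ⟨fun c hc => ?_, fun c hc => ?_⟩
  · obtain ⟨z, hz, hcz⟩ := exists_boxCox_gt hρ hc
    have hlim : Tendsto
        (fun t => ENNReal.ofReal |Real.log (U (z * t) / (z ^ γ * U t)) / A t|) atTop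
        (𝓝 (ENNReal.ofReal |boxCox ρ z|)) :=
      (ENNReal.continuous_ofReal.tendsto _).comp
        (h.tendsto_log_ratio hUev (zero_lt_one.trans hz)).abs
    rw [abs_of_pos (boxCox_pos ρ hz)] at hlim
    filter_upwards [hlim.eventually (lt_mem_nhds hcz), h.eventually_ne_zero] with t h1 h2
    rw [Ap_top_div_ofReal_abs h2]
    exact h1.trans_le (le_iSup₂ (f := fun z (_ : z ∈ Ioi (1 : ℝ)) =>
      ENNReal.ofReal |Real.log (U (z * t) / (z ^ γ * U t)) / A t|) z hz)
  · rw [cConst, if_pos rfl] at hc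
    have hρ0 : ρ ≠ 0 := fun h0 => by rw [if_pos h0] at hc; exact not_top_lt hc
    rw [if_neg hρ0] at hc
    have hρ' : ρ < 0 := lt_of_le_of_ne hρ hρ0
    have hr : Real.exp 1 ^ ρ < 1 :=
      Real.rpow_lt_one_of_one_lt_of_neg (Real.one_lt_exp_iff.2 one_pos) hρ'
    -- The sum of the full geometric series tends to `boxCox ρ e / (1 - e^ρ) = 1/|ρ|` as `η → 0`, so
    -- chaining unit steps loses nothing in the limit.
    have hlim : Tendsto (fun η : ℝ => ENNReal.ofReal
        ((boxCox ρ (Real.exp 1) + η) / (1 - (Real.exp 1 ^ ρ + η)))) (𝓝[>] 0)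
        (𝓝 (ENNReal.ofReal (1 / |ρ|))) := by
      refine (ENNReal.continuous_ofReal.tendsto _).comp ?_
      have hc : ContinuousAt (fun η : ℝ =>
          (boxCox ρ (Real.exp 1) + η) / (1 - (Real.exp 1 ^ ρ + η))) 0 :=
        ContinuousAt.div (by fun_prop) (by fun_prop) (by rw [add_zero]; linarith)
      have := hc.tendsto.mono_left (nhdsWithin_le_nhds (s := Ioi 0))
      convert this using 2
      have h1 : 1 - Real.exp 1 ^ ρ ≠ 0 := by linarith
      rw [add_zero, add_zero, boxCox, if_neg hρ0, abs_of_neg hρ']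
      field_simp
      ring
    have hη1 : ∀ᶠ η in 𝓝[>] (0 : ℝ), Real.exp 1 ^ ρ + η < 1 := by
      filter_upwards [Ioo_mem_nhdsGT (sub_pos.2 hr)] with η hη
      linarith [hη.2]
    obtain ⟨η, ⟨hηc, hη1⟩, hη0⟩ := ((hlim.eventually (gt_mem_nhds hc)).and hη1 |>.and
      self_mem_nhdsWithin).exists
    have hη0 : 0 < η := hη0
    have hκ := boxCox_pos ρ (Real.one_lt_exp_iff.2 one_pos)
    filter_upwards [h.eventually_forall_abs_log_ratio_le ht₀ hU hpos
      (lt_add_of_pos_right _ hη0) (lt_add_of_pos_right _ hη0), h.eventually_ne_zero] with t h1 h2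
    rw [Ap_top_div_ofReal_abs h2]
    refine lt_of_le_of_lt (iSup₂_le fun z hz => ENNReal.ofReal_le_ofReal ((h1 z hz).trans ?_)) hηc
    rw [div_eq_mul_inv]
    have hq0 : 0 ≤ Real.exp 1 ^ ρ + η := by positivity
    refine mul_le_mul_of_nonneg_left ?_ (by linarith)
    rw [← tsum_geometric_of_lt_one hq0 hη1]
    exact (summable_geometric_of_lt_one hq0 hη1).sum_le_tsum _ fun j _ => pow_nonneg hq0 j

/-- The last term dominates: `exp(ε ⌊log z⌋) ≤ z^ε`. A ratio above `1` also covers `ρ = 0`, where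
the geometric series is not summable. -/
theorem geom_sum_floor_log_le {ε z : ℝ} (hε : 0 < ε) (hz : 1 < z) :
    ∑ j ∈ Finset.range (⌊Real.log z⌋₊ + 1), Real.exp ε ^ j
      ≤ Real.exp ε / (Real.exp ε - 1) * z ^ ε := by
  have hz0 : 0 < z := by linarith
  have hq : 0 < Real.exp ε - 1 := sub_pos.2 (Real.one_lt_exp_iff.2 hε)
  rw [geom_sum_eq (by linarith), div_mul_eq_mul_div]
  refine div_le_div_of_nonneg_right ?_ hq.le
  have h1 : Real.exp ε ^ ⌊Real.log z⌋₊ ≤ z ^ ε := by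
    rw [← Real.exp_nat_mul, Real.rpow_def_of_pos hz0]
    gcongr
    exact Nat.floor_le (Real.log_nonneg hz.le)
  rw [pow_succ]
  nlinarith [Real.exp_pos ε]

theorem tendsto_Ap_div {t₀ : ℝ} (h : SecondOrderCondition U γ ρ A) (ht₀ : 0 < t₀)
    (hU : MonotoneOn U (Ici t₀)) (hpos : 0 < U t₀) {p : ℝ≥0∞} (hp : 1 ≤ p) :
    Tendsto (fun t => Ap U γ p t / ENNReal.ofReal |A t|) atTop (𝓝 (cConst p ρ)) := by
  by_cases htop : p = ∞
  · rw [htop]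
    exact tendsto_Ap_top_div h ht₀ hU hpos
  have hp0 : 0 < p.toReal := ENNReal.toReal_pos (zero_lt_one.trans_le hp).ne' htop
  have hUev : ∀ᶠ t in atTop, 0 < U t := by
    filter_upwards [eventually_ge_atTop t₀] with t ht
    exact hpos.trans_le (hU self_mem_Ici ht ht)
  set ε := 1 / (2 * p.toReal) with hε
  have hε0 : 0 < ε := by positivity
  have hq1 : 1 < Real.exp ε := Real.one_lt_exp_iff.2 hε0
  have hκ := boxCox_pos ρ (Real.one_lt_exp_iff.2 one_pos)
  have hq : Real.exp 1 ^ ρ < Real.exp ε :=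
    (Real.rpow_le_one_of_one_le_of_nonpos (Real.one_le_exp zero_le_one) h.rho_nonpos).trans_lt hq1
  rw [cConst, if_neg htop]
  refine (tendsto_lintegral_rpow_div_sq
    (L := fun t z => Real.log (U (z * t) / (z ^ γ * U t)) / A t) (h := boxCox ρ)
    (C := (boxCox ρ (Real.exp 1) + 1) * (Real.exp ε / (Real.exp ε - 1))) (p := p.toReal)
    ?_ hp0 ?_ ?_ ?_).congr' ?_
  · exact mul_nonneg (by linarith) (div_nonneg (Real.exp_pos _).le (by linarith))
  · filter_upwards [eventually_ge_atTop t₀] with t ht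
    exact (aemeasurable_log_ratio γ (ht₀.trans_le ht) (hU.mono (Ici_subset_Ici.2 ht))).div_const _
  · exact fun z hz => h.tendsto_log_ratio hUev (zero_lt_one.trans hz)
  · filter_upwards [h.eventually_forall_abs_log_ratio_le ht₀ hU hpos (lt_add_one _) hq]
      with t ht z hz
    refine (ht z hz).trans ?_
    rw [mul_assoc]
    exact mul_le_mul_of_nonneg_left (geom_sum_floor_log_le hε0 hz) (by linarith)
  · filter_upwards [h.eventually_ne_zero] with t ht
    exact (Ap_div_ofReal_abs hp htop ht).symm

end SecondOrder

end ExtremeWasserstein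

theorem mainTheorem4 (μ : Measure ℝ) [IsProbabilityMeasure μ] (γ : ℝ) (hγ : 0 < γ)
    (t₀ : ℝ) (ht₀ : 1 < t₀) (hU : 0 < ExtremeWasserstein.tailQuantile μ t₀)
    (p : ℝ≥0∞) (hp : 1 ≤ p) :
    (∀ {Ω : Type*} [MeasurableSpace Ω] (Pr : Measure Ω) [IsProbabilityMeasure Pr] (X Z : Ω → ℝ),
      AEMeasurable X Pr → AEMeasurable Z Pr → Pr.map Z = paretoMeasure 1 1 →
      X =ᵐ[Pr] (fun ω => ExtremeWasserstein.tailQuantile μ (Z ω)) →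
      ∀ t : ℝ, t₀ ≤ t →
        ExtremeWasserstein.wasserstein p
          (ExtremeWasserstein.LogHalfLine.ofReal
            (ExtremeWasserstein.exceedanceLaw Pr X Z (ExtremeWasserstein.tailQuantile μ) t))
          (ExtremeWasserstein.LogHalfLine.ofReal (paretoMeasure 1 (1 / γ)))
        = ExtremeWasserstein.Ap (ExtremeWasserstein.tailQuantile μ) γ p t) ∧
    (p ≠ ∞ → ExtremeWasserstein.InDomainOfAttraction μ γ →
      (∃ M : ℝ, ∀ t : ℝ, t₀ ≤ t →
        ExtremeWasserstein.Ap (ExtremeWasserstein.tailQuantile μ) γ p t ≤ ENNReal.ofReal M) ∧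
      Tendsto (ExtremeWasserstein.Ap (ExtremeWasserstein.tailQuantile μ) γ p) atTop (𝓝 0)) ∧
    (∀ (ρ : ℝ) (A : ℝ → ℝ),
      ExtremeWasserstein.SecondOrderCondition (ExtremeWasserstein.tailQuantile μ) γ ρ A →
      Tendsto (fun t => ExtremeWasserstein.Ap (ExtremeWasserstein.tailQuantile μ) γ p t
          / ENNReal.ofReal |A t|)
        atTop (𝓝 (ExtremeWasserstein.cConst p ρ))) := by
  have hpos : ∀ {t}, t₀ ≤ t → 0 < ExtremeWasserstein.tailQuantile μ t := fun ht =>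
    hU.trans_le (ExtremeWasserstein.monotoneOn_tailQuantile μ ht₀ (ht₀.trans_le ht) ht)
  refine ⟨?_, fun htop h => ?_, fun ρ A h => ?_⟩
  · intro Ω _ Pr _ X Z _ hZ hPZ hXZ t ht
    exact ExtremeWasserstein.wasserstein_exceedanceLaw μ hγ hp Pr hZ hPZ hXZ
      (ht₀.trans_le ht) (hpos ht)
  · exact ExtremeWasserstein.Ap_bounded_and_tendsto_zero μ hγ ht₀ hU hp htop h
  · exact ExtremeWasserstein.tendsto_Ap_div h (by linarith)
      ((ExtremeWasserstein.monotoneOn_tailQuantile μ).mono fun s hs => ht₀.trans_le hs) hU hp
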